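/- **Model.** There are $n$ asynchronous processes. They communicate through atomic single-writer multi-reader registers; each process owns a countable family of registers, of unbounded size. A *schedule* is a finite sequence of process ids. A deterministic algorithm gives each process a local state machine. Whenever a process is scheduled it performs one atomic step: it reads one register of any process, or writes one of its own registers. A process that is between tasks starts the next task of its request sequence with that step (request sequences are infinite, and a task is revealed to the process only when it starts). A step may be the final operation of the current task, which then returns a vector of $n$ values. **Object.** The object stores a value $v_q\in V$ for each process $q$, with given initial values. Its tasks are $\mathrm{collect}$ and $\mathrm{writeCollect}(v)$, $v\in V$. When a process $p$ performs $\mathrm{writeCollect}(v)$, $v_p$ becomes $v$ at the first operation of the task. Both kinds of task return a vector $x$ such that each $x_q$ is a value held by $v_q$ at some moment between the first and the final operation of the task; in particular no returned value was overwritten before the task started. Let $T$ be a set of tasks that contains $\mathrm{writeCollect}(v)$ and $\mathrm{writeCollect}(w)$ for some $v\ne w$. An algorithm *implements the object for $T$* if every task completed in any execution, with any requests from $T$, returns such a vector. Let $Q\subseteq T$ be nonempty. For example, with $T$ the set of all tasks, $Q=\{\mathrm{collect}\}$ measures the throughput of collects and $Q=T$ that of the full object; with $T=Q$ the set of all write-collects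 one gets pure write-collect. **Competitiveness.** Let $\mathrm{done}(A,\sigma,R)$ be the total number of tasks completed when $A$ runs under the schedule $\sigma$ with request sequences $R$. Let $\mathrm{opt}(\sigma)=\max_{A^*,R^*}\mathrm{done}(A^*,\sigma,R^*)$, where $A^*$ ranges over the deterministic wait-free algorithms that implement the object for $T$, and $R^*$ over the families of request sequences with tasks in $Q$. For real $k>0$, $A$ is *$k$-throughput-competitive* if there is a constant $c'$ such that $\mathrm{done}(A,\sigma,R)+c'\ge \frac1k\,\mathrm{opt}(\sigma)$ for all schedules $\sigma$ and all request sequences $R$ with tasks in $Q$. **Theorem.** No deterministic algorithm for collect or write-collect has throughput competitiveness less than $\Omega(\sqrt n)$. Precisely: there are an absolute constant $c>0$ and an $N$ such that for all $n\ge N$, all $V$, all initial values and all $T,Q$ as above, if a deterministic algorithm $A$ for $n$ processes (wait-free or not) implements the object for $T$ and is $k$-throughput-competitive, then $k\ge c\sqrt n$. -/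

import Mathlib

universe u

namespace CollectModel

/-- The tasks that can be requested of a collect / write-collect object holding values in `V`. -/
inductive Task (V : Type u) : Type u where
  | collect : Task V
  | writeCollect (v : V) : Task V

/-- One atomic shared-memory step. Process `q` owns the registers `(q, 0), (q, 1), …`.
A step is either a read of an arbitrary register `(q, j)`, after which the process continues
according to the value read, or a write of `v` to the process's own register `j`.
In both cases the step yields the new local state and, if it is the final operation of the
current task, the vector returned by that task. -/
inductive Action (n : ℕ) (V State Val : Type u) : Type u where
  | read (q : Fin n) (j : ℕ) (cont : Val → State × Option (Fin n → V))
  | write (j : ℕ) (v : Val) (cont : State × Option (Fin n → V))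

/-- A deterministic shared-memory algorithm for `n` processes that communicate through atomic
single-writer multi-reader registers. `invoke` hands the next requested task to a process that
is between tasks, and `act` is the next step of a process that is executing a task. -/
structure Algorithm (n : ℕ) (V : Type u) where
  State : Type u
  Val : Type u
  initState : Fin n → State
  initMem : Fin n → ℕ → Val
  invoke : Fin n → State → Task V → State
  act : Fin n → State → Action n V State Val

/-- A set of request sequences: `R p i` is the `i`-th task requested of process `p`. -/
abbrev Requests (n : ℕ) (V : Type u) := Fin n → ℕ → Task V

namespace Algorithm

variable {n : ℕ} {V : Type u}

/-- A global configuration: local states, register contents, and for each process the number of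
tasks that it has started and the number of tasks that it has completed. -/
structure Config (A : Algorithm n V) where
  loc : Fin n → A.State
  mem : Fin n → ℕ → A.Val
  started : Fin n → ℕ
  completed : Fin n → ℕ

/-- The initial configuration. -/
def initConfig (A : Algorithm n V) : A.Config where
  loc := A.initState
  mem := A.initMem
  started := fun _ => 0
  completed := fun _ => 0

/-- Process `p` is between two tasks. -/
def Config.Idle {A : Algorithm n V} (c : A.Config) (p : Fin n) : Prop :=
  c.started p = c.completed p

instance {A : Algorithm n V} (c : A.Config) (p : Fin n) : Decidable (c.Idle p) :=
  inferInstanceAs (Decidable (c.started p = c.completed p))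

/-- The local state from which the next step of `p` is taken; a process that is between tasks
starts its next requested task with this step. -/
def stepState (A : Algorithm n V) (R : Requests n V) (c : A.Config) (p : Fin n) : A.State :=
  if c.Idle p then A.invoke p (c.loc p) (R p (c.started p)) else c.loc p

/-- The local state of `p` after its next step, together with the vector returned by the current
task of `p` if that step is its final operation. -/
def stepOutcome (A : Algorithm n V) (R : Requests n V) (c : A.Config) (p : Fin n) :
    A.State × Option (Fin n → V) :=
  match A.act p (A.stepState R c p) with
  | .read q j cont => cont (c.mem q j)
  | .write _ _ cont => cont

/-- The register contents after the next step of `p`. -/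
def stepMem (A : Algorithm n V) (R : Requests n V) (c : A.Config) (p : Fin n) :
    Fin n → ℕ → A.Val :=
  match A.act p (A.stepState R c p) with
  | .read _ _ _ => c.mem
  | .write j v _ => Function.update c.mem p (Function.update (c.mem p) j v)

/-- The configuration after the next step of `p`. -/
def step (A : Algorithm n V) (R : Requests n V) (c : A.Config) (p : Fin n) : A.Config where
  loc := Function.update c.loc p (A.stepOutcome R c p).1
  mem := A.stepMem R c p
  started := Function.update c.started p
    (if c.Idle p then c.started p + 1 else c.started p)
  completed := Function.update c.completed p
    (if (A.stepOutcome R c p).2.isSome then c.completed p + 1 else c.completed p)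

/-- The configuration reached from the initial one by running `A` on the requests `R` under the
finite schedule `σ`. -/
def run (A : Algorithm n V) (R : Requests n V) (σ : List (Fin n)) : A.Config :=
  σ.foldl (A.step R) A.initConfig

/-- The total number of tasks completed when running `A` on `R` under the schedule `σ`. -/
def done (A : Algorithm n V) (σ : List (Fin n)) (R : Requests n V) : ℕ :=
  ∑ p, (A.run R σ).completed p

end Algorithm

/-- The content of an object register with initial value `v₀` whose owner has started the first
`k` of the tasks `r 0, r 1, …`: a write-collect takes effect at its first operation. -/
def written {V : Type u} (v₀ : V) (r : ℕ → Task V) : ℕ → V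
  | 0 => v₀
  | k + 1 =>
    match r k with
    | .collect => written v₀ r k
    | .writeCollect v => v

namespace Algorithm

variable {n : ℕ} {V : Type u}

/-- The content of the object register of process `q` after the schedule `σ`. -/
def objectValue (A : Algorithm n V) (init : Fin n → V) (R : Requests n V)
    (σ : List (Fin n)) (q : Fin n) : V :=
  written (init q) (R q) ((A.run R σ).started q)

/-- `A` is a correct implementation, with initial object values `init`, for requests composed of
tasks in `T`: whenever a step of `p` after `σ` completes a task of `p` and returns `x`, each
component `x q` is a value that the object register of `q` held at some moment `ρ` between the
first operation and the final operation of that task. (Each moment `ρ` with the same number of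
started tasks of `p` as at the final operation belongs to the task being completed.) -/
def Implements (A : Algorithm n V) (init : Fin n → V) (T : Set (Task V)) : Prop :=
  ∀ R : Requests n V, (∀ p i, R p i ∈ T) →
    ∀ (σ : List (Fin n)) (p : Fin n) (x : Fin n → V),
      (A.stepOutcome R (A.run R σ) p).2 = some x →
        ∀ q, ∃ ρ, ρ <+: σ ++ [p] ∧
          (A.run R ρ).started p = (A.run R (σ ++ [p])).started p ∧
          x q = A.objectValue init R ρ q

/-- `A` is wait-free for requests composed of tasks in `T`: a process that takes infinitely many
steps completes infinitely many tasks, whatever the other processes do. -/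
def WaitFree (A : Algorithm n V) (T : Set (Task V)) : Prop :=
  ∀ R : Requests n V, (∀ p i, R p i ∈ T) →
    ∀ (σ : ℕ → Fin n) (p : Fin n), (∀ t, ∃ t', t ≤ t' ∧ σ t' = p) →
      ∀ k, ∃ t, k ≤ (A.run R ((List.range t).map σ)).completed p

end Algorithm

/-- The numbers of tasks that champions complete under the schedule `σ`: a champion is a correct
and wait-free implementation for the tasks in `T`, run on any requests composed of tasks in `Q`. -/
def championScores {n : ℕ} {V : Type u} (init : Fin n → V) (T Q : Set (Task V))
    (σ : List (Fin n)) : Set ℕ :=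
  {d | ∃ B : Algorithm.{u} n V, B.Implements init T ∧ B.WaitFree T ∧
    ∃ R : Requests n V, (∀ p i, R p i ∈ Q) ∧ B.done σ R = d}

/-- The performance of the best champion on the best requests for the fixed schedule `σ`. -/
noncomputable def opt {n : ℕ} {V : Type u} (init : Fin n → V) (T Q : Set (Task V))
    (σ : List (Fin n)) : ℕ :=
  sSup (championScores init T Q σ)

/-- `A` is `k`-throughput-competitive on requests composed of tasks in `Q`, against champions that
are correct for tasks in `T`. -/
def Algorithm.ThroughputCompetitive {n : ℕ} {V : Type u} (A : Algorithm n V) (init : Fin n → V)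
    (T Q : Set (Task V)) (k : ℝ) : Prop :=
  0 < k ∧ ∃ c : ℝ, ∀ (σ : List (Fin n)) (R : Requests n V), (∀ p i, R p i ∈ Q) →
    (A.done σ R : ℝ) + c ≥ 1 / k * (opt init T Q σ : ℝ)

/-- A step completes at most one task. -/
theorem Algorithm.done_le_length {n : ℕ} {V : Type u} (A : Algorithm n V) (R : Requests n V)
    (σ : List (Fin n)) : A.done σ R ≤ σ.length := by
  induction σ using List.reverseRecOn with
  | nil => simp [Algorithm.done, Algorithm.run, Algorithm.initConfig]
  | append_singleton σ p ih =>
    have h : A.done (σ ++ [p]) R ≤ A.done σ R + 1 := by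
      have key : ∀ q, (A.run R (σ ++ [p])).completed q ≤
          (A.run R σ).completed q + (if q = p then 1 else 0) := by
        intro q
        by_cases hq : q = p
        · subst hq
          simp only [Algorithm.run, List.foldl_append, List.foldl_cons, List.foldl_nil,
            Algorithm.step, Function.update_self, if_true]
          split_ifs <;> omega
        · simp [Algorithm.run, Algorithm.step, hq]
      calc A.done (σ ++ [p]) R
          ≤ ∑ q, ((A.run R σ).completed q + (if q = p then 1 else 0)) :=
            Finset.sum_le_sum fun q _ => key q
        _ = A.done σ R + 1 := by
            rw [Finset.sum_add_distrib]; simp [Algorithm.done]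
    simpa using h.trans (Nat.succ_le_succ ih)

/-- The supremum in `opt` is over a bounded set. -/
theorem bddAbove_championScores {n : ℕ} {V : Type u} (init : Fin n → V) (T Q : Set (Task V))
    (σ : List (Fin n)) : BddAbove (championScores init T Q σ) := by
  refine ⟨σ.length, ?_⟩
  rintro d ⟨B, -, -, R, -, rfl⟩
  exact B.done_le_length R σ

end CollectModel

/-! A collect is cheap for a process that can borrow a vector gathered entirely during its own task,
but it has to know from whom to borrow. The champion knows the schedule and hence knows; `A` can be
kept ignorant.

Ignorance is costly: a task that a process starts and completes while running alone must read a
register of every other process. If it skipped `g`, then `g` could have begun a write-collect of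
another value just before, unnoticed (`exists_readTarget_of_solo`). So such a task takes at least `n
- 1` steps. For this `g` must be able to reach the end of its pending task; a competitive algorithm
allows that, since otherwise a champion would gain without bound
(`ThroughputCompetitive.obstructionFree`).

From the current configuration, draw an arrow from each process to those it would read in its next
`3 * h` solo steps. Out-degrees are at most `3 * h`, so when `(m + 1) * (6 * h + 1) ≤ n` there are
`m + 1` processes without arrows among them (`exists_independent`). One becomes the leader, the
others followers, and only these run during an epoch of `h` rounds. To each follower the epoch looks
like a solo run of fewer than `n` steps, so it completes at most one task, the pending one; the
leader completes at most two tasks per round. `A` gains at most `m + 2 * h` (`exists_epoch`).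

The champion lets the leader gather a fresh vector in each round while each follower spends three
steps: announce its task, note the leader's task number, take the newer vector. This gives at least
`m * h` tasks per epoch (`Champion.done_epochs`). It is correct and wait-free under every schedule,
because a follower that finds no newer vector gathers its own.

With `h = m` of order `√n`, many epochs yield a ratio of at least `m ^ 2 / (3 * m) = m / 3`. -/

namespace CollectModel

/-- The owner of the register that an action reads, if it is a read. -/
def Action.target {n : ℕ} {V State Val : Type u} : Action n V State Val → Option (Fin n)
  | .read q _ _ => some q
  | .write _ _ _ => none

/-! ### Local views and indistinguishable steps -/

namespace Algorithm

variable {n : ℕ} {V : Type u} {A : Algorithm n V} {R R' : Requests n V}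

theorem run_append_singleton (A : Algorithm n V) (R : Requests n V) (σ : List (Fin n))
    (p : Fin n) : A.run R (σ ++ [p]) = A.step R (A.run R σ) p := by
  simp [run]

theorem run_append (A : Algorithm n V) (R : Requests n V) (σ τ : List (Fin n)) :
    A.run R (σ ++ τ) = τ.foldl (A.step R) (A.run R σ) := by
  simp [run]

theorem run_append_replicate_succ (A : Algorithm n V) (R : Requests n V) (σ : List (Fin n))
    (p : Fin n) (i : ℕ) : A.run R (σ ++ List.replicate (i + 1) p) =
      A.step R (A.run R (σ ++ List.replicate i p)) p := by
  rw [List.replicate_succ', ← List.append_assoc, run_append_singleton]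

/-- Two configurations agree on everything that belongs to process `q`. -/
def SameAt (c d : A.Config) (q : Fin n) : Prop :=
  c.loc q = d.loc q ∧ c.mem q = d.mem q ∧ c.started q = d.started q ∧
    c.completed q = d.completed q

theorem SameAt.refl (c : A.Config) (q : Fin n) : SameAt c c q := ⟨rfl, rfl, rfl, rfl⟩

theorem SameAt.symm {c d : A.Config} {q : Fin n} (h : SameAt c d q) : SameAt d c q :=
  ⟨h.1.symm, h.2.1.symm, h.2.2.1.symm, h.2.2.2.symm⟩

theorem SameAt.trans {c d e : A.Config} {q : Fin n} (h : SameAt c d q) (h' : SameAt d e q) :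
    SameAt c e q :=
  ⟨h.1.trans h'.1, h.2.1.trans h'.2.1, h.2.2.1.trans h'.2.2.1, h.2.2.2.trans h'.2.2.2⟩

theorem stepMem_of_ne (c : A.Config) {p q : Fin n} (h : q ≠ p) :
    A.stepMem R c p q = c.mem q := by
  unfold stepMem
  cases A.act p (A.stepState R c p) <;> simp [h]

theorem sameAt_step_of_ne (c : A.Config) {p q : Fin n} (h : q ≠ p) :
    SameAt (A.step R c p) c q := by
  refine ⟨?_, stepMem_of_ne c h, ?_, ?_⟩ <;> simp [step, h]

theorem sameAt_foldl (c : A.Config) {q : Fin n} {τ : List (Fin n)} (h : q ∉ τ) :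
    SameAt (τ.foldl (A.step R) c) c q := by
  induction τ generalizing c with
  | nil => exact SameAt.refl _ _
  | cons p τ ih =>
    simp only [List.mem_cons, not_or] at h
    exact (ih _ h.2).trans (sameAt_step_of_ne c h.1)

theorem sameAt_run_append (σ : List (Fin n)) {q : Fin n} {τ : List (Fin n)} (h : q ∉ τ) :
    SameAt (A.run R (σ ++ τ)) (A.run R σ) q := by
  rw [run_append]
  exact sameAt_foldl _ h

/-- The owner of the register that the next step of `p` reads, if that step is a read. -/
def readTarget (A : Algorithm n V) (R : Requests n V) (c : A.Config) (p : Fin n) :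
    Option (Fin n) :=
  (A.act p (A.stepState R c p)).target

theorem SameAt.idle_iff {c d : A.Config} {p : Fin n} (h : SameAt c d p) :
    c.Idle p ↔ d.Idle p := by
  unfold Config.Idle
  rw [h.2.2.1, h.2.2.2]

theorem SameAt.stepState_eq {c d : A.Config} {p : Fin n} (h : SameAt c d p) (hR : R p = R' p) :
    A.stepState R c p = A.stepState R' d p := by
  unfold stepState
  by_cases hi : c.Idle p
  · rw [if_pos hi, if_pos (h.idle_iff.1 hi), h.1, h.2.2.1, hR]
  · rw [if_neg hi, if_neg (mt h.idle_iff.2 hi), h.1]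

/-- A step depends only on what belongs to `p` and on the one register that it reads. All
indistinguishability arguments below rest on this. -/
theorem SameAt.stepOutcome_eq {c d : A.Config} {p : Fin n} (h : SameAt c d p) (hR : R p = R' p)
    (hread : ∀ r, A.readTarget R c p = some r → c.mem r = d.mem r) :
    A.stepOutcome R c p = A.stepOutcome R' d p := by
  have hs := h.stepState_eq hR
  unfold readTarget at hread
  unfold stepOutcome
  rw [← hs]
  cases ha : A.act p (A.stepState R c p) with
  | read q j cont =>
    have := hread q (by rw [ha]; rfl)
    simp only [this]
  | write j v cont => rfl

theorem SameAt.step {c d : A.Config} {p : Fin n} (h : SameAt c d p) (hR : R p = R' p)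
    (hread : ∀ r, A.readTarget R c p = some r → c.mem r = d.mem r) :
    SameAt (A.step R c p) (A.step R' d p) p := by
  have ho := h.stepOutcome_eq hR hread
  have hs := h.stepState_eq hR
  have hi := h.idle_iff
  obtain ⟨-, h2, h3, h4⟩ := h
  refine ⟨?_, ?_, ?_, ?_⟩
  · simp [Algorithm.step, ho]
  · change A.stepMem R c p p = A.stepMem R' d p p
    unfold stepMem
    rw [← hs]
    cases A.act p (A.stepState R c p) <;> simp [h2]
  · simp [Algorithm.step, hi, h3]
  · simp [Algorithm.step, ho, h4]

theorem started_le_step (c : A.Config) (p q : Fin n) :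
    c.started q ≤ (A.step R c p).started q := by
  by_cases h : q = p
  · subst h
    simp only [step, Function.update_self]
    split_ifs <;> omega
  · exact (sameAt_step_of_ne c h).2.2.1.ge

theorem completed_le_step (c : A.Config) (p q : Fin n) :
    c.completed q ≤ (A.step R c p).completed q := by
  by_cases h : q = p
  · subst h
    simp only [step, Function.update_self]
    split_ifs <;> omega
  · exact (sameAt_step_of_ne c h).2.2.2.ge

theorem started_le_foldl (c : A.Config) (τ : List (Fin n)) (q : Fin n) :
    c.started q ≤ (τ.foldl (A.step R) c).started q := by
  induction τ generalizing c with
  | nil => exact le_rfl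
  | cons p τ ih => exact (started_le_step c p q).trans (ih _)

theorem completed_le_foldl (c : A.Config) (τ : List (Fin n)) (q : Fin n) :
    c.completed q ≤ (τ.foldl (A.step R) c).completed q := by
  induction τ generalizing c with
  | nil => exact le_rfl
  | cons p τ ih => exact (completed_le_step c p q).trans (ih _)

theorem started_mono {σ τ : List (Fin n)} (h : σ <+: τ) (q : Fin n) :
    (A.run R σ).started q ≤ (A.run R τ).started q := by
  obtain ⟨ρ, rfl⟩ := h
  rw [run_append]
  exact started_le_foldl _ _ _

theorem completed_mono {σ τ : List (Fin n)} (h : σ <+: τ) (q : Fin n) :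
    (A.run R σ).completed q ≤ (A.run R τ).completed q := by
  obtain ⟨ρ, rfl⟩ := h
  rw [run_append]
  exact completed_le_foldl _ _ _

theorem started_step_of_idle {c : A.Config} {p : Fin n} (h : c.Idle p) :
    (A.step R c p).started p = c.started p + 1 := by
  simp [step, h]

theorem started_step_of_not_idle {c : A.Config} {p : Fin n} (h : ¬ c.Idle p) :
    (A.step R c p).started p = c.started p := by
  simp [step, h]

theorem completed_step_of_some {c : A.Config} {p : Fin n}
    (h : (A.stepOutcome R c p).2.isSome) :
    (A.step R c p).completed p = c.completed p + 1 := by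
  simp [step, h]

theorem completed_step_of_none {c : A.Config} {p : Fin n}
    (h : ¬ (A.stepOutcome R c p).2.isSome) :
    (A.step R c p).completed p = c.completed p := by
  simp [step, h]

/-- A process is executing at most one task. -/
theorem completed_le_started_le (A : Algorithm n V) (R : Requests n V) (σ : List (Fin n))
    (p : Fin n) : (A.run R σ).completed p ≤ (A.run R σ).started p ∧
      (A.run R σ).started p ≤ (A.run R σ).completed p + 1 := by
  induction σ using List.reverseRecOn with
  | nil => simp [run, initConfig]
  | append_singleton σ q ih =>
    rw [run_append_singleton]
    by_cases h : p = q
    · subst h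
      by_cases hi : (A.run R σ).Idle p <;>
      by_cases ho : (A.stepOutcome R (A.run R σ) p).2.isSome
      · rw [started_step_of_idle hi, completed_step_of_some ho]
        unfold Config.Idle at hi; omega
      · rw [started_step_of_idle hi, completed_step_of_none ho]
        unfold Config.Idle at hi; omega
      · rw [started_step_of_not_idle hi, completed_step_of_some ho]
        unfold Config.Idle at hi; omega
      · rw [started_step_of_not_idle hi, completed_step_of_none ho]
        unfold Config.Idle at hi; omega
    · have := sameAt_step_of_ne (R := R) (A.run R σ) h
      rw [this.2.2.1, this.2.2.2]
      exact ih

/-- After a step of `p`, `p` is between tasks if and only if the step completed a task. -/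
theorem idle_step_iff (σ : List (Fin n)) (p : Fin n) :
    (A.run R (σ ++ [p])).Idle p ↔ (A.stepOutcome R (A.run R σ) p).2.isSome := by
  have hb := completed_le_started_le A R σ p
  rw [run_append_singleton]
  change (A.step R _ p).started p = (A.step R _ p).completed p ↔ _
  by_cases hi : (A.run R σ).Idle p <;>
  by_cases ho : (A.stepOutcome R (A.run R σ) p).2.isSome
  · rw [started_step_of_idle hi, completed_step_of_some ho]
    unfold Config.Idle at hi; simp only [ho, iff_true]; omega
  · rw [started_step_of_idle hi, completed_step_of_none ho]
    unfold Config.Idle at hi; simp only [ho, iff_false, Bool.false_eq_true]; omega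
  · rw [started_step_of_not_idle hi, completed_step_of_some ho]
    unfold Config.Idle at hi; simp only [ho, iff_true]; omega
  · rw [started_step_of_not_idle hi, completed_step_of_none ho]
    unfold Config.Idle at hi; simp only [ho, iff_false, Bool.false_eq_true]; omega

/-- A run depends only on the requests that have been revealed. -/
theorem run_congr {σ : List (Fin n)}
    (h : ∀ p i, i < (A.run R σ).started p → R p i = R' p i) : A.run R σ = A.run R' σ := by
  induction σ using List.reverseRecOn with
  | nil => rfl
  | append_singleton σ p ih =>
    have hσ := ih fun q i hi =>
      h q i (hi.trans_le (started_mono (List.prefix_append _ _) q))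
    rw [run_append_singleton, run_append_singleton, ← hσ]
    have hs : A.stepState R (A.run R σ) p = A.stepState R' (A.run R σ) p := by
      unfold stepState
      split_ifs with hi
      · rw [h p _ (by rw [run_append_singleton, started_step_of_idle hi]; omega)]
      · rfl
    have ho : A.stepOutcome R (A.run R σ) p = A.stepOutcome R' (A.run R σ) p := by
      unfold stepOutcome
      rw [hs]
    have hm : A.stepMem R (A.run R σ) p = A.stepMem R' (A.run R σ) p := by
      unfold stepMem
      rw [hs]
    simp only [step, ho, hm]

/-! ### Tasks of a process that runs alone -/

theorem completed_solo_of_none {σ : List (Fin n)} {p : Fin n} {b : ℕ}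
    (h : ∀ i < b, ¬ (A.stepOutcome R (A.run R (σ ++ List.replicate i p)) p).2.isSome) :
    (A.run R (σ ++ List.replicate b p)).completed p = (A.run R σ).completed p := by
  induction b with
  | zero => simp
  | succ b ih =>
    rw [run_append_replicate_succ, completed_step_of_none (h b (by omega)),
      ih fun i hi => h i (by omega)]

/-- A process that starts and completes a task while running alone reads a register of every
other process: it would otherwise miss a write-collect started just before. -/
theorem exists_readTarget_of_solo {init : Fin n → V} {T : Set (Task V)}
    (hA : A.Implements init T) (hR : ∀ p i, R p i ∈ T)
    (hT : ∃ v w : V, v ≠ w ∧ Task.writeCollect v ∈ T ∧ Task.writeCollect w ∈ T)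
    {σ : List (Fin n)} {q g : Fin n} (hgq : g ≠ q) {m : ℕ}
    (hm : (A.run R (σ ++ List.replicate m g)).Idle g) (hq : (A.run R σ).Idle q) {j : ℕ}
    (hj : (A.stepOutcome R (A.run R (σ ++ List.replicate j q)) q).2.isSome) :
    ∃ i ≤ j, A.readTarget R (A.run R (σ ++ List.replicate i q)) q = some g := by
  by_contra! hno
  obtain ⟨x, hx⟩ := Option.isSome_iff_exists.1 hj
  obtain ⟨v', hv', hv'T⟩ : ∃ v', v' ≠ x g ∧ Task.writeCollect v' ∈ T := by
    obtain ⟨v, w, hvw, hv, hw⟩ := hT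
    by_cases h : v = x g
    · exact ⟨w, fun h' => hvw (h.trans h'.symm), hw⟩
    · exact ⟨v, h, hv⟩
  set k := (A.run R (σ ++ List.replicate m g)).started g with hk
  -- Request `k` of `g` is the first one not revealed when `g` becomes idle, so replacing it does
  -- not change the run so far.
  let R' : Requests n V := fun p i => if p = g ∧ i = k then .writeCollect v' else R p i
  have hR' : ∀ p i, R' p i ∈ T := by
    intro p i
    simp only [R']
    split_ifs
    exacts [hv'T, hR p i]
  have hRr : ∀ r, r ≠ g → R r = R' r := by
    intro r hr
    funext i
    simp [R', hr]
  have hrun : A.run R (σ ++ List.replicate m g) = A.run R' (σ ++ List.replicate m g) := by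
    refine run_congr fun p i hi => ?_
    simp only [R']
    split_ifs with h
    · obtain ⟨rfl, rfl⟩ := h
      exact absurd hi (lt_irrefl _)
    · rfl
  -- In the alternative execution `g` finishes its pending task and performs the first operation of
  -- the write-collect of `v'` before `q` moves.
  set α := σ ++ List.replicate m g ++ [g] with hα
  have hα0 : ∀ r, r ≠ g → SameAt (A.run R σ) (A.run R' α) r := by
    intro r hr
    rw [hα, run_append_singleton, ← hrun]
    refine SameAt.trans ?_ (sameAt_step_of_ne _ hr).symm
    exact (sameAt_run_append σ (fun h => hr (List.eq_of_mem_replicate h))).symm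
  have hαg : (A.run R' α).started g = k + 1 := by
    rw [hα, run_append_singleton, ← hrun, started_step_of_idle hm]
  clear_value α
  -- As `q` never reads from `g`, its solo run cannot tell the two executions apart and again
  -- returns `x`.
  have hsim : ∀ i ≤ j, ∀ r, r ≠ g →
      SameAt (A.run R (σ ++ List.replicate i q)) (A.run R' (α ++ List.replicate i q)) r := by
    intro i
    induction i with
    | zero => simpa using hα0
    | succ i ih =>
      intro hi r hr
      have ih := ih (by omega)
      rw [run_append_replicate_succ, run_append_replicate_succ]
      by_cases hrq : r = q
      · subst hrq
        refine (ih r hr).step (hRr r hr) fun t ht => ?_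
        have : t ≠ g := fun h => hno i (by omega) (h ▸ ht)
        exact (ih t this).2.1
      · exact ((sameAt_step_of_ne _ hrq).trans (ih r hr)).trans (sameAt_step_of_ne _ hrq).symm
  have hx' : (A.stepOutcome R' (A.run R' (α ++ List.replicate j q)) q).2 = some x := by
    rw [← (hsim j le_rfl q hgq.symm).stepOutcome_eq (hRr q hgq.symm) fun t ht =>
      (hsim j le_rfl t fun h => hno j le_rfl (h ▸ ht)).2.1]
    exact hx
  obtain ⟨ρ, hρ, hρs, hρx⟩ := hA R' hR' _ q x hx' g
  have hidle : (A.run R' α).Idle q := by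
    have := hα0 q hgq.symm
    unfold Config.Idle at hq ⊢
    rw [← this.2.2.1, ← this.2.2.2, hq]
  have hlt : (A.run R' α).started q <
      (A.run R' (α ++ List.replicate j q ++ [q])).started q := by
    have h1 := started_step_of_idle (R := R') hidle
    rw [← run_append_singleton] at h1
    have h2 : α ++ [q] <+: α ++ List.replicate j q ++ [q] := by
      rw [List.append_assoc, ← List.replicate_succ', List.replicate_succ]
      exact ⟨List.replicate j q, by simp⟩
    have h3 := started_mono (A := A) (R := R') h2 q
    omega
  have hpre : α <+: α ++ List.replicate j q ++ [q] := by
    rw [List.append_assoc]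
    exact List.prefix_append _ _
  -- A moment no later than `α` precedes the task of `q`; from `α` on `g` takes no step, so the only
  -- admissible value is `v'`.
  rcases List.prefix_or_prefix_of_prefix hρ hpre with h | ⟨τ, rfl⟩
  · have := started_mono (A := A) (R := R') h q
    omega
  · have hτ : g ∉ τ := by
      rw [List.append_assoc, List.prefix_append_right_inj] at hρ
      intro hg
      have := hρ.subset hg
      rw [← List.replicate_succ'] at this
      exact hgq (List.eq_of_mem_replicate this)
    have hst := (sameAt_run_append (A := A) (R := R') α hτ).2.2.1
    rw [hαg] at hst
    refine hv' ?_
    rw [hρx, objectValue, hst]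
    simp [written, R']

/-- Every process completes its current task if it runs alone. -/
def ObstructionFree (A : Algorithm n V) (R : Requests n V) : Prop :=
  ∀ (σ : List (Fin n)) (p : Fin n), ∃ m, (A.run R (σ ++ List.replicate m p)).Idle p

/-- A task started and completed by a process that runs alone takes `n - 1` steps. -/
theorem pred_le_of_solo {init : Fin n → V} {T : Set (Task V)}
    (hA : A.Implements init T) (hR : ∀ p i, R p i ∈ T)
    (hT : ∃ v w : V, v ≠ w ∧ Task.writeCollect v ∈ T ∧ Task.writeCollect w ∈ T)
    (hO : A.ObstructionFree R) {σ : List (Fin n)} {q : Fin n} (hq : (A.run R σ).Idle q) {j : ℕ}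
    (hj : (A.stepOutcome R (A.run R (σ ++ List.replicate j q)) q).2.isSome) : n - 1 ≤ j + 1 := by
  classical
  have hsub : (Finset.univ.erase q).image some ⊆ (Finset.range (j + 1)).image
      fun i => A.readTarget R (A.run R (σ ++ List.replicate i q)) q := by
    intro t ht
    simp only [Finset.mem_image, Finset.mem_erase, Finset.mem_univ, and_true] at ht
    obtain ⟨g, hg, rfl⟩ := ht
    obtain ⟨m, hm⟩ := hO σ g
    obtain ⟨i, hi, h⟩ := exists_readTarget_of_solo hA hR hT hg hm hq hj
    exact Finset.mem_image.2 ⟨i, by simp; omega, h⟩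
  have := (Finset.card_le_card hsub).trans Finset.card_image_le
  rwa [Finset.card_image_of_injective _ (Option.some_injective _), Finset.card_erase_of_mem
    (Finset.mem_univ _), Finset.card_univ, Fintype.card_fin, Finset.card_range] at this

/-- The run is cut after its first completion: by `pred_le_of_solo` this took at least `n - 1`
steps, and `q` is idle again. Multiplying by `n - 1` avoids division. -/
theorem completed_solo_of_idle {init : Fin n → V} {T : Set (Task V)}
    (hA : A.Implements init T) (hR : ∀ p i, R p i ∈ T)
    (hT : ∃ v w : V, v ≠ w ∧ Task.writeCollect v ∈ T ∧ Task.writeCollect w ∈ T)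
    (hO : A.ObstructionFree R) {q : Fin n} (b : ℕ) {σ : List (Fin n)}
    (hq : (A.run R σ).Idle q) :
    (A.run R (σ ++ List.replicate b q)).completed q * (n - 1) ≤
      (A.run R σ).completed q * (n - 1) + b := by
  classical
  induction b using Nat.strong_induction_on generalizing σ with
  | _ b ih =>
    by_cases h : ∃ i, i < b ∧
        (A.stepOutcome R (A.run R (σ ++ List.replicate i q)) q).2.isSome
    · let j := Nat.find h
      obtain ⟨hjb, hj⟩ := Nat.find_spec h
      have hmin : ∀ i < j, ¬ (A.stepOutcome R (A.run R (σ ++ List.replicate i q)) q).2.isSome :=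
        fun i hi hs => Nat.find_min h hi ⟨by omega, hs⟩
      have hc := completed_solo_of_none hmin
      have hc' := completed_step_of_some hj
      rw [← run_append_replicate_succ] at hc'
      have hidle : (A.run R (σ ++ List.replicate (j + 1) q)).Idle q := by
        rw [List.replicate_succ', ← List.append_assoc]
        exact (idle_step_iff _ _).2 hj
      have hn := pred_le_of_solo hA hR hT hO hq hj
      have := ih (b - (j + 1)) (by omega) hidle
      rw [List.append_assoc, List.replicate_append_replicate,
        show j + 1 + (b - (j + 1)) = b by omega, hc', hc, add_mul] at this
      omega
    · rw [completed_solo_of_none fun i hi hs => h ⟨i, hi, hs⟩]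
      omega

/-- A process that runs alone completes at most one task quickly. -/
theorem completed_solo {init : Fin n → V} {T : Set (Task V)}
    (hA : A.Implements init T) (hR : ∀ p i, R p i ∈ T)
    (hT : ∃ v w : V, v ≠ w ∧ Task.writeCollect v ∈ T ∧ Task.writeCollect w ∈ T)
    (hO : A.ObstructionFree R) (q : Fin n) (b : ℕ) (σ : List (Fin n)) :
    (A.run R (σ ++ List.replicate b q)).completed q * (n - 1) ≤
      ((A.run R σ).completed q + 1) * (n - 1) + (b - 1) := by
  classical
  by_cases h : ∃ i, i < b ∧
      (A.stepOutcome R (A.run R (σ ++ List.replicate i q)) q).2.isSome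
  · let j := Nat.find h
    obtain ⟨hjb, hj⟩ := Nat.find_spec h
    have hmin : ∀ i < j, ¬ (A.stepOutcome R (A.run R (σ ++ List.replicate i q)) q).2.isSome :=
      fun i hi hs => Nat.find_min h hi ⟨by omega, hs⟩
    have hc := completed_solo_of_none hmin
    have hc' := completed_step_of_some hj
    rw [← run_append_replicate_succ] at hc'
    have hidle : (A.run R (σ ++ List.replicate (j + 1) q)).Idle q := by
      rw [List.replicate_succ', ← List.append_assoc]
      exact (idle_step_iff _ _).2 hj
    -- The first completion may belong to a task that was nearly finished at the outset: it costs at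
    -- least one step, whence the `+ 1` and the `b - 1`.
    have := completed_solo_of_idle hA hR hT hO (b - (j + 1)) hidle
    rw [List.append_assoc, List.replicate_append_replicate,
      show j + 1 + (b - (j + 1)) = b by omega, hc', hc] at this
    omega
  · rw [completed_solo_of_none fun i hi hs => h ⟨i, hi, hs⟩, add_mul]
    omega

end Algorithm

end CollectModel

/-! ### The adversary: epochs in which the algorithm gains little -/

namespace CollectModel

/-- A directed graph with small out-degrees has a large independent set. -/
theorem exists_independent {α : Type*} [DecidableEq α] (N : α → Finset α) (S : ℕ)
    (hN : ∀ a, (N a).card ≤ S) (m : ℕ) (W : Finset α) (hW : m * (2 * S + 1) ≤ W.card) :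
    ∃ G ⊆ W, G.card = m ∧ ∀ a ∈ G, ∀ b ∈ G, b ≠ a → b ∉ N a := by
  induction m generalizing W with
  | zero => exact ⟨∅, by simp, by simp, by simp⟩
  | succ m ih =>
    have hne : W.Nonempty := by
      rw [← Finset.card_pos]
      refine lt_of_lt_of_le ?_ hW
      positivity
    -- In-degrees within `W` sum to the same number as out-degrees, so some vertex `a` has in-degree
    -- at most `S`.
    have hsum : ∑ a ∈ W, (W.filter fun b => a ∈ N b).card ≤ ∑ _a ∈ W, S := by
      have := Finset.sum_card_bipartiteAbove_eq_sum_card_bipartiteBelow (s := W) (t := W)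
        (fun a b => a ∈ N b)
      simp only [Finset.bipartiteAbove, Finset.bipartiteBelow] at this
      rw [this]
      refine Finset.sum_le_sum fun b _ => le_trans (Finset.card_le_card ?_) (hN b)
      intro a ha
      exact (Finset.mem_filter.1 ha).2
    obtain ⟨a, haW, ha⟩ := Finset.exists_le_of_sum_le hne hsum
    -- Discarding `a` with its neighbours in both directions costs at most `2 * S + 1` vertices and
    -- makes `a` independent of the rest.
    let X := insert a (N a ∪ W.filter fun b => a ∈ N b)
    have hX : X.card ≤ 2 * S + 1 := by
      have h1 := Finset.card_insert_le a (N a ∪ W.filter fun b => a ∈ N b)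
      have h2 := Finset.card_union_le (N a) (W.filter fun b => a ∈ N b)
      have h3 := hN a
      simp only [X]
      omega
    have hW' : m * (2 * S + 1) ≤ (W \ X).card := by
      have := Finset.le_card_sdiff X W
      rw [add_mul] at hW
      omega
    obtain ⟨G, hGW, hGm, hG⟩ := ih (W \ X) hW'
    have hGX : ∀ b ∈ G, b ∈ W ∧ b ≠ a ∧ b ∉ N a ∧ a ∉ N b := by
      intro b hb
      have := Finset.mem_sdiff.1 (hGW hb)
      simp only [X, Finset.mem_insert, Finset.mem_union, Finset.mem_filter, not_or] at this
      exact ⟨this.1, this.2.1, this.2.2.1, fun h => this.2.2.2 ⟨this.1, h⟩⟩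
    refine ⟨insert a G, ?_, ?_, ?_⟩
    · exact Finset.insert_subset haW fun b hb => (hGX b hb).1
    · rw [Finset.card_insert_of_notMem fun h => (hGX a h).2.1 rfl, hGm]
    · intro b hb c hc hcb
      rcases Finset.mem_insert.1 hb with rfl | hbG
      · rcases Finset.mem_insert.1 hc with rfl | hcG
        · exact absurd rfl hcb
        · exact (hGX c hcG).2.2.1
      · rcases Finset.mem_insert.1 hc with rfl | hcG
        · exact (hGX b hbG).2.2.2
        · exact hG b hbG c hcG hcb

/-- Each follower takes two steps, then the leader runs for as long as a task may take, and then
each follower takes another step. -/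
def roundSchedule {n : ℕ} (p : Fin n) (F : List (Fin n)) : List (Fin n) :=
  F ++ (F ++ (List.replicate (n + 2) p ++ F))

/-- `h` rounds with the same leader and the same followers. -/
def epochSchedule {n : ℕ} (h : ℕ) (p : Fin n) (F : List (Fin n)) : List (Fin n) :=
  (List.replicate h (roundSchedule p F)).flatten

theorem epochSchedule_succ {n : ℕ} (h : ℕ) (p : Fin n) (F : List (Fin n)) :
    epochSchedule (h + 1) p F = roundSchedule p F ++ epochSchedule h p F := by
  simp [epochSchedule, List.replicate_succ]

theorem mem_epochSchedule {n h : ℕ} {p : Fin n} {F : List (Fin n)} {x : Fin n}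
    (hx : x ∈ epochSchedule h p F) : x = p ∨ x ∈ F := by
  simp only [epochSchedule, List.mem_flatten, List.mem_replicate] at hx
  obtain ⟨l, ⟨-, rfl⟩, hx⟩ := hx
  simp only [roundSchedule, List.mem_append, List.mem_replicate] at hx
  tauto

theorem count_epochSchedule {n h : ℕ} {p : Fin n} {F : List (Fin n)} (hF : F.Nodup) {f : Fin n}
    (hf : f ∈ F) (hp : p ∉ F) : (epochSchedule h p F).count f = 3 * h := by
  have hpf : p ≠ f := fun h => hp (h ▸ hf)
  induction h with
  | zero => simp [epochSchedule]
  | succ h ih =>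
    rw [epochSchedule_succ, List.count_append, ih]
    simp only [roundSchedule, List.count_append, List.count_eq_one_of_mem hF hf,
      List.count_replicate, beq_iff_eq, hpf, if_false]
    omega

namespace Algorithm

variable {n : ℕ} {V : Type u} {A : Algorithm n V} {R : Requests n V}

/-- A process that reads from no other active process runs as if it were alone. -/
theorem sameAt_solo {σ : List (Fin n)} {G : Set (Fin n)} {f : Fin n} {S : ℕ}
    (hind : ∀ i < S, ∀ g ∈ G, g ≠ f →
      A.readTarget R (A.run R (σ ++ List.replicate i f)) f ≠ some g)
    (hfG : f ∈ G) (τ : List (Fin n)) (hτ : ∀ x ∈ τ, x ∈ G) (hS : τ.count f ≤ S) :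
    SameAt (A.run R (σ ++ List.replicate (τ.count f) f)) (A.run R (σ ++ τ)) f := by
  induction τ using List.reverseRecOn with
  | nil => exact SameAt.refl _ _
  | append_singleton τ x ih =>
    by_cases hx : x = f
    · subst hx
      simp only [List.count_append, List.count_singleton_self] at hS ⊢
      have ih := ih (fun y hy => hτ y (List.mem_append_left _ hy)) (by omega)
      rw [run_append_replicate_succ, ← List.append_assoc, run_append_singleton]
      refine ih.step rfl fun r hr => ?_
      by_cases hrx : r = x
      · rw [hrx]
        exact ih.2.1
      -- A process outside `G` takes no step in either run, so its registers still hold what they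
      -- held after `σ`.
      · have hrG : r ∉ G := fun h => hind _ (by omega) r h hrx hr
        exact ((sameAt_run_append σ fun h => hrx (List.eq_of_mem_replicate h)).trans
          (sameAt_run_append σ fun h => hrG (hτ r (List.mem_append_left _ h))).symm).2.1
    · have hc : (τ ++ [x]).count f = τ.count f := by
        simp [List.count_append, hx]
      rw [hc] at hS ⊢
      rw [← List.append_assoc, run_append_singleton]
      exact (ih (fun y hy => hτ y (List.mem_append_left _ hy)) hS).trans
        (sameAt_step_of_ne _ (Ne.symm hx)).symm

section Solo

variable {init : Fin n → V} {T : Set (Task V)} (hA : A.Implements init T)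
  (hR : ∀ p i, R p i ∈ T)
  (hT : ∃ v w : V, v ≠ w ∧ Task.writeCollect v ∈ T ∧ Task.writeCollect w ∈ T)
  (hO : A.ObstructionFree R)

include hA hR hT hO

/-- In a round the leader moves only in one uninterrupted block of `n + 2` steps. Beyond one
possibly cheap completion, two more would need `2 * (n - 1) ≤ n + 1`, which fails. -/
theorem completed_leader (hn : 5 ≤ n) {p : Fin n} {F : List (Fin n)} (hp : p ∉ F) (h : ℕ)
    (σ : List (Fin n)) : (A.run R (σ ++ epochSchedule h p F)).completed p ≤
      (A.run R σ).completed p + 2 * h := by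
  induction h generalizing σ with
  | zero => simp [epochSchedule]
  | succ h ih =>
    rw [epochSchedule_succ, ← List.append_assoc]
    have h1 := ih (σ ++ roundSchedule p F)
    have h2 := (sameAt_run_append (A := A) (R := R)
      (σ ++ F ++ F ++ List.replicate (n + 2) p) hp).2.2.2
    have h3 := (sameAt_run_append (A := A) (R := R) (σ ++ F) hp).2.2.2
    have h4 := (sameAt_run_append (A := A) (R := R) σ hp).2.2.2
    have h5 := completed_solo hA hR hT hO p (n + 2) (σ ++ F ++ F)
    have h6 : σ ++ F ++ F ++ List.replicate (n + 2) p ++ F = σ ++ roundSchedule p F := by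
      simp [roundSchedule]
    rw [h6] at h2
    rw [h3, h4] at h5
    have h7 : (A.run R (σ ++ F ++ F ++ List.replicate (n + 2) p)).completed p ≤
        (A.run R σ).completed p + 2 := by
      by_contra hc
      have := Nat.mul_le_mul_right (n - 1) (show (A.run R σ).completed p + 1 + 2 ≤
        (A.run R (σ ++ F ++ F ++ List.replicate (n + 2) p)).completed p by omega)
      rw [add_mul _ 2] at this
      omega
    omega

/-- By independence the follower behaves as in a solo run of `3 * h` steps. A second completion
would need `n - 1` steps besides at least one for the first, but `3 * h < n`. -/
theorem completed_follower {p : Fin n} {F : List (Fin n)} (hF : F.Nodup) (hp : p ∉ F) {h : ℕ}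
    (hh : 3 * h < n) {σ : List (Fin n)} {f : Fin n} (hf : f ∈ F)
    (hind : ∀ i < 3 * h, ∀ g ∈ p :: F, g ≠ f →
      A.readTarget R (A.run R (σ ++ List.replicate i f)) f ≠ some g) :
    (A.run R (σ ++ epochSchedule h p F)).completed f ≤ (A.run R σ).completed f + 1 := by
  have hc := count_epochSchedule (h := h) hF hf hp
  have h1 := (sameAt_solo (G := {g | g ∈ p :: F}) hind (List.mem_cons_of_mem _ hf)
    (epochSchedule h p F) (fun x hx => List.mem_cons.2 (mem_epochSchedule hx)) hc.le).2.2.2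
  rw [hc] at h1
  rw [← h1]
  rcases Nat.eq_zero_or_pos h with rfl | hpos
  · simp
  by_contra hcon
  have h2 := completed_solo hA hR hT hO f (3 * h) σ
  have := Nat.mul_le_mul_right (n - 1) (show (A.run R σ).completed f + 1 + 1 ≤
    (A.run R (σ ++ List.replicate (3 * h) f)).completed f by omega)
  rw [add_mul _ 1] at this
  omega

/-- In a suitable epoch the algorithm completes few tasks. -/
theorem exists_epoch (hn : 5 ≤ n) (m h : ℕ) (hh : 3 * h < n)
    (hm : (m + 1) * (2 * (3 * h) + 1) ≤ n) (σ : List (Fin n)) :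
    ∃ (p : Fin n) (F : List (Fin n)), F.Nodup ∧ p ∉ F ∧ F.length = m ∧
      A.done (σ ++ epochSchedule h p F) R ≤ A.done σ R + (m + 2 * h) := by
  classical
  -- The processes that `f` would read from in its next `3 * h` steps, were it to run alone after
  -- `σ`.
  let N : Fin n → Finset (Fin n) := fun f => ((Finset.range (3 * h)).image fun i =>
    A.readTarget R (A.run R (σ ++ List.replicate i f)) f).eraseNone
  have hN : ∀ f, (N f).card ≤ 3 * h := by
    intro f
    have h1 := (Finset.range (3 * h)).card_image_le (f := fun i =>
      A.readTarget R (A.run R (σ ++ List.replicate i f)) f)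
    rw [Finset.card_range] at h1
    refine le_trans ?_ h1
    exact Finset.card_eraseNone_le _
  have hmem : ∀ f, ∀ i < 3 * h, ∀ g,
      A.readTarget R (A.run R (σ ++ List.replicate i f)) f = some g → g ∈ N f := by
    intro f i hi g hg
    simp only [N, Finset.mem_eraseNone, Finset.mem_image, Finset.mem_range]
    exact ⟨i, hi, hg⟩
  obtain ⟨G, -, hGm, hG⟩ := exists_independent N (3 * h) hN (m + 1) Finset.univ (by simpa using hm)
  obtain ⟨p, hpG⟩ := Finset.card_pos.1 (show 0 < G.card by omega)
  have hFG : ∀ x, x ∈ (G.erase p).toList ↔ x ≠ p ∧ x ∈ G := by simp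
  have hp : p ∉ (G.erase p).toList := by simp
  refine ⟨p, (G.erase p).toList, Finset.nodup_toList _, hp, ?_, ?_⟩
  · rw [Finset.length_toList, Finset.card_erase_of_mem hpG]
    omega
  · have key : ∀ q, (A.run R (σ ++ epochSchedule h p (G.erase p).toList)).completed q ≤
        (A.run R σ).completed q + ((if q ∈ G.erase p then 1 else 0) +
          if q = p then 2 * h else 0) := by
      intro q
      by_cases hqp : q = p
      · subst hqp
        have := completed_leader hA hR hT hO hn hp h σ
        simpa using this
      · by_cases hqG : q ∈ G
        · have := completed_follower hA hR hT hO (Finset.nodup_toList (G.erase p)) hp hh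
            (σ := σ) (f := q) ((hFG q).2 ⟨hqp, hqG⟩) (by
              intro i hi g hg hgq hr
              have hgG : g ∈ G := by
                rcases List.mem_cons.1 hg with rfl | hg
                · exact hpG
                · exact ((hFG g).1 hg).2
              exact hG q hqG g hgG hgq (hmem q i hi g hr))
          simpa [hqp, hqG] using this
        · have := (sameAt_run_append (A := A) (R := R) σ (q := q)
            (τ := epochSchedule h p (G.erase p).toList) (by
              intro hx
              rcases mem_epochSchedule hx with h' | h'
              · exact hqp h'
              · exact hqG ((hFG q).1 h').2)).2.2.2
          rw [this]
          exact Nat.le_add_right _ _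
    refine (Finset.sum_le_sum fun q _ => key q).trans ?_
    rw [Finset.sum_add_distrib, Finset.sum_add_distrib]
    simp only [Finset.sum_ite_mem, Finset.univ_inter, Finset.sum_const, smul_eq_mul, mul_one,
      Finset.sum_ite_eq', Finset.mem_univ, if_true, Finset.card_erase_of_mem hpG, hGm, done]
    omega

end Solo

end Algorithm

/-- The concatenation of epochs with the given leaders and followers. -/
def epochsSchedule {n : ℕ} (h : ℕ) (L : List (Fin n × List (Fin n))) : List (Fin n) :=
  L.flatMap fun e => epochSchedule h e.1 e.2

namespace Algorithm

/-- There are arbitrarily long sequences of epochs in which the algorithm completes few tasks. -/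
theorem exists_epochs {n : ℕ} {V : Type u} {A : Algorithm n V} {R : Requests n V}
    {init : Fin n → V} {T : Set (Task V)} (hA : A.Implements init T)
    (hR : ∀ p i, R p i ∈ T)
    (hT : ∃ v w : V, v ≠ w ∧ Task.writeCollect v ∈ T ∧ Task.writeCollect w ∈ T)
    (hO : A.ObstructionFree R) (hn : 5 ≤ n) (m h : ℕ) (hh : 3 * h < n)
    (hm : (m + 1) * (2 * (3 * h) + 1) ≤ n) (M : ℕ) :
    ∃ L : List (Fin n × List (Fin n)), L.length = M ∧
      (∀ e ∈ L, e.2.Nodup ∧ e.1 ∉ e.2 ∧ e.2.length = m) ∧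
      A.done (epochsSchedule h L) R ≤ M * (m + 2 * h) := by
  induction M with
  | zero => exact ⟨[], rfl, by simp, by simp [epochsSchedule, done, run, initConfig]⟩
  | succ M ih =>
    obtain ⟨L, hL, hLF, hLd⟩ := ih
    -- `A` is deterministic and the requests are fixed, so each epoch can be tailored to the
    -- configuration reached so far.
    obtain ⟨p, F, hF, hp, hFm, hd⟩ :=
      exists_epoch hA hR hT hO hn m h hh hm (epochsSchedule h L)
    refine ⟨L ++ [(p, F)], by simp [hL], ?_, ?_⟩
    · intro e he
      rcases List.mem_append.1 he with he | he
      · exact hLF e he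
      · rw [List.mem_singleton.1 he]
        exact ⟨hF, hp, hFm⟩
    · have : epochsSchedule h (L ++ [(p, F)]) = epochsSchedule h L ++ epochSchedule h p F := by
        simp [epochsSchedule]
      rw [this, add_mul]
      omega

end Algorithm

end CollectModel

/-! ### The champion algorithm -/

namespace CollectModel

/-- The content of an object register with content `v` after the first operation of a task. -/
def Task.newValue {V : Type u} : Task V → V → V
  | .collect, v => v
  | .writeCollect w, _ => w

theorem written_succ {V : Type u} (v₀ : V) (r : ℕ → Task V) (k : ℕ) :
    written v₀ r (k + 1) = (r k).newValue (written v₀ r k) := by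
  rw [written]
  cases r k <;> rfl

namespace Champion

/-- Register contents: a task number, a value, and a vector of values. -/
structure Entry (n : ℕ) (V : Type u) : Type u where
  count : ℕ
  val : V
  vec : Fin n → V

/-- The control state of a process. `peek p` is about to read the number of tasks that `p` has
started, `check p c` has read that number and is about to read the latest vector gathered by `p`,
and `gather todo x` has still to read the values of the processes in `todo`. -/
inductive Phase (n : ℕ) (V : Type u) : Type u where
  | start (hint : Option (Fin n))
  | peek (p : Fin n)
  | check (p : Fin n) (c : ℕ)
  | gather (todo : List (Fin n)) (x : Fin n → V)

/-- Local states: the number of started tasks, the current value, the hints for the coming tasks,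
and the control state. -/
structure LocalState (n : ℕ) (V : Type u) : Type u where
  count : ℕ
  val : V
  plan : List (Option (Fin n))
  phase : Phase n V

variable {n : ℕ} {V : Type u}

/-- The control state after the first operation of a task. -/
def Phase.ofHint (init : Fin n → V) : Option (Fin n) → Phase n V
  | some p => .peek p
  | none => .gather (List.finRange n) init

/-- Each task first announces its number and the value of the process in register `0`. If the
plan names a process `p` for this task, and `p` completes a task of its own during the task, then
the vector gathered by `p` is returned. Otherwise the values of all processes are read, and made
available in register `1`. -/
abbrev algorithm (init : Fin n → V) (plan : Fin n → List (Option (Fin n))) : Algorithm n V where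
  State := LocalState n V
  Val := Entry n V
  initState p := ⟨0, init p, plan p, .start none⟩
  initMem p _ := ⟨0, init p, init⟩
  invoke _ s t := ⟨s.count + 1, t.newValue s.val, s.plan.tail, .start s.plan.head?.join⟩
  act _ s :=
    match s.phase with
    | .start hint => .write 0 ⟨s.count, s.val, init⟩ ({ s with phase := .ofHint init hint }, none)
    | .peek p => .read p 0 fun e => ({ s with phase := .check p e.count }, none)
    | .check p c => .read p 1 fun e =>
        if c < e.count then (s, some e.vec)
        else ({ s with phase := .gather (List.finRange n) init }, none)
    | .gather (q :: todo) x => .read q 0 fun e =>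
        ({ s with phase := .gather todo (Function.update x q e.val) }, none)
    | .gather [] x => .write 1 ⟨s.count, s.val, x⟩ (s, some x)

variable {init : Fin n → V} {plan : Fin n → List (Option (Fin n))} {R : Requests n V}

open Algorithm

section Step

variable {c : (algorithm init plan).Config} {p : Fin n} {s : LocalState n V}
  (hs : (algorithm init plan).stepState R c p = s)

include hs

theorem step_start {hint : Option (Fin n)} (h : s.phase = .start hint) :
    (algorithm init plan).stepOutcome R c p = ({ s with phase := .ofHint init hint }, none) ∧
    (algorithm init plan).stepMem R c p =
      Function.update c.mem p (Function.update (c.mem p) 0 ⟨s.count, s.val, init⟩) := by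
  have : (algorithm init plan).act p s =
      .write 0 ⟨s.count, s.val, init⟩ ({ s with phase := .ofHint init hint }, none) := by
    simp only [algorithm, h]
  constructor
  · unfold stepOutcome
    rw [hs, this]
  · unfold stepMem
    rw [hs, this]

theorem step_peek {q : Fin n} (h : s.phase = .peek q) :
    (algorithm init plan).stepOutcome R c p = ({ s with phase := .check q (c.mem q 0).count }, none) ∧
    (algorithm init plan).stepMem R c p = c.mem := by
  have : (algorithm init plan).act p s = .read q 0 fun e => ({ s with phase := .check q e.count }, none) := by
    simp only [algorithm, h]
  constructor
  · unfold stepOutcome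
    rw [hs, this]
  · unfold stepMem
    rw [hs, this]

theorem step_check {q : Fin n} {k : ℕ} (h : s.phase = .check q k) :
    (algorithm init plan).stepOutcome R c p = (if k < (c.mem q 1).count then (s, some (c.mem q 1).vec)
        else ({ s with phase := .gather (List.finRange n) init }, none)) ∧
    (algorithm init plan).stepMem R c p = c.mem := by
  have : (algorithm init plan).act p s = .read q 1 fun e =>
        if k < e.count then (s, some e.vec)
        else ({ s with phase := .gather (List.finRange n) init }, none) := by
    simp only [algorithm, h]
  constructor
  · unfold stepOutcome
    rw [hs, this]
  · unfold stepMem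
    rw [hs, this]

theorem step_gather_cons {q : Fin n} {todo : List (Fin n)} {x : Fin n → V}
    (h : s.phase = .gather (q :: todo) x) :
    (algorithm init plan).stepOutcome R c p =
      ({ s with phase := .gather todo (Function.update x q (c.mem q 0).val) }, none) ∧
    (algorithm init plan).stepMem R c p = c.mem := by
  have : (algorithm init plan).act p s = .read q 0 fun e =>
        ({ s with phase := .gather todo (Function.update x q e.val) }, none) := by
    simp only [algorithm, h]
  constructor
  · unfold stepOutcome
    rw [hs, this]
  · unfold stepMem
    rw [hs, this]

theorem step_gather_nil {x : Fin n → V} (h : s.phase = .gather [] x) :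
    (algorithm init plan).stepOutcome R c p = (s, some x) ∧
    (algorithm init plan).stepMem R c p =
      Function.update c.mem p (Function.update (c.mem p) 1 ⟨s.count, s.val, x⟩) := by
  have : (algorithm init plan).act p s = .write 1 ⟨s.count, s.val, x⟩ (s, some x) := by
    simp only [algorithm, h]
  constructor
  · unfold stepOutcome
    rw [hs, this]
  · unfold stepMem
    rw [hs, this]

end Step

/-- An upper bound on the number of steps before the current task is completed. -/
def Phase.rank : Phase n V → ℕ
  | .start _ => n + 5
  | .peek _ => n + 4
  | .check _ _ => n + 3
  | .gather todo _ => todo.length + 1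

/-- A failed check falls back on a full gather of rank `n + 1`, which lies below the rank of
`check`. A bad hint thus delays a task but cannot block it. -/
theorem rank_step (c : (algorithm init plan).Config) (p : Fin n) :
    ((algorithm init plan).stepOutcome R c p).2.isSome ∨
      (show LocalState n V from ((algorithm init plan).stepOutcome R c p).1).phase.rank <
        (show LocalState n V from (algorithm init plan).stepState R c p).phase.rank := by
  obtain ⟨s, hs⟩ : ∃ s : LocalState n V, (algorithm init plan).stepState R c p = s := ⟨_, rfl⟩
  rw [hs]
  change _ ∨ _ < s.phase.rank
  cases h : s.phase with
  | start hint =>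
    rw [(step_start hs h).1]
    right
    cases hint <;> simp [Phase.ofHint, Phase.rank]
  | peek q =>
    rw [(step_peek hs h).1]
    simp [Phase.rank]
  | check q k =>
    rw [(step_check hs h).1]
    split_ifs <;> simp [Phase.rank]
  | gather todo x =>
    cases todo with
    | nil =>
      rw [(step_gather_nil hs h).1]
      simp
    | cons q todo =>
      rw [(step_gather_cons hs h).1]
      simp [Phase.rank]

end Champion

/-! ### Wait-freedom from a decreasing rank -/

namespace Algorithm

variable {n : ℕ} {V : Type u} {A : Algorithm n V} {R : Requests n V}

theorem run_range_succ (σ : ℕ → Fin n) (t : ℕ) :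
    A.run R ((List.range (t + 1)).map σ) = A.step R (A.run R ((List.range t).map σ)) (σ t) := by
  rw [List.range_succ, List.map_append, List.map_singleton, run_append_singleton]

/-- The local state of a process persists until its next step. -/
theorem exists_next_step {σ : ℕ → Fin n} {p : Fin n} (d t : ℕ) (h : σ (t + d) = p) :
    ∃ t', t ≤ t' ∧ σ t' = p ∧
      SameAt (A.run R ((List.range t').map σ)) (A.run R ((List.range t).map σ)) p := by
  induction d generalizing t with
  | zero => exact ⟨t, le_rfl, h, SameAt.refl _ _⟩
  | succ d ih =>
    by_cases ht : σ t = p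
    · exact ⟨t, le_rfl, ht, SameAt.refl _ _⟩
    · obtain ⟨t', h1, h2, h3⟩ := ih (t + 1) (by rw [← h]; congr 1; omega)
      refine ⟨t', by omega, h2, h3.trans ?_⟩
      rw [run_range_succ]
      exact sameAt_step_of_ne _ (Ne.symm ht)

/-- An algorithm is wait-free if a rank of local states decreases during each task. -/
theorem waitFree_of_rank (T : Set (Task V)) (rank : A.State → ℕ)
    (h : ∀ R c p, (A.stepOutcome R c p).2.isSome ∨
      rank (A.stepOutcome R c p).1 < rank (A.stepState R c p)) : A.WaitFree T := by
  intro R _ σ p hσ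
  have key : ∀ r t, rank (A.stepState R (A.run R ((List.range t).map σ)) p) ≤ r →
      ∃ t', (A.run R ((List.range t).map σ)).completed p + 1 ≤
        (A.run R ((List.range t').map σ)).completed p := by
    intro r
    induction r using Nat.strong_induction_on with
    | _ r ih =>
      intro t ht
      obtain ⟨t₁, ht₁, hp₁⟩ := hσ t
      obtain ⟨t', -, hp', hsame⟩ := exists_next_step (A := A) (R := R) (σ := σ) (p := p) (t₁ - t) t
        (by rw [← hp₁]; congr 1; omega)
      rw [← hsame.stepState_eq rfl] at ht
      rw [← hsame.2.2.2]
      have hrun := run_range_succ (A := A) (R := R) σ t'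
      rw [hp'] at hrun
      by_cases hsome : (A.stepOutcome R (A.run R ((List.range t').map σ)) p).2.isSome
      · refine ⟨t' + 1, ?_⟩
        rw [hrun, completed_step_of_some hsome]
      · have hlt := (h R (A.run R ((List.range t').map σ)) p).resolve_left hsome
        have hidle := mt (idle_step_iff (A := A) (R := R) ((List.range t').map σ) p).1 hsome
        rw [run_append_singleton, ← hrun] at hidle
        have hst : A.stepState R (A.run R ((List.range (t' + 1)).map σ)) p =
            (A.stepOutcome R (A.run R ((List.range t').map σ)) p).1 := by
          unfold stepState
          rw [if_neg hidle, hrun]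
          simp [step]
        obtain ⟨t'', ht''⟩ := ih _ (lt_of_lt_of_le hlt ht) (t' + 1) (by rw [hst])
        rw [hrun, completed_step_of_none hsome] at ht''
        exact ⟨t'', ht''⟩
  intro k
  induction k with
  | zero => exact ⟨0, Nat.zero_le _⟩
  | succ k ih =>
    obtain ⟨t, ht⟩ := ih
    obtain ⟨t', ht'⟩ := key _ t le_rfl
    exact ⟨t', by omega⟩

end Algorithm

/-! ### Correctness of the champion under every schedule -/

namespace Champion

open Algorithm

variable {n : ℕ} {V : Type u}

theorem waitFree (init : Fin n → V) (plan : Fin n → List (Option (Fin n))) (T : Set (Task V)) :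
    (algorithm init plan).WaitFree T :=
  waitFree_of_rank T (fun s : LocalState n V => s.phase.rank) fun _ c p => rank_step c p

variable {init : Fin n → V} {plan : Fin n → List (Option (Fin n))} {R : Requests n V}

theorem objectValue_append_of_started {A : Algorithm n V} {σ τ : List (Fin n)} {q : Fin n}
    (h : (A.run R τ).started q = (A.run R σ).started q) :
    A.objectValue init R τ q = A.objectValue init R σ q := by
  rw [objectValue, objectValue, h]

/-- The value `v` was held by the object register of `j` during the current task of `q`. -/
def Fresh (A : Algorithm n V) (init : Fin n → V) (R : Requests n V) (σ : List (Fin n))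
    (q j : Fin n) (v : V) : Prop :=
  ∃ ρ, ρ <+: σ ∧ (A.run R ρ).started q = (A.run R σ).started q ∧ v = A.objectValue init R ρ j

theorem Fresh.append {A : Algorithm n V} {σ : List (Fin n)} {q j p : Fin n} {v : V}
    (h : Fresh A init R σ q j v)
    (hs : (A.run R (σ ++ [p])).started q = (A.run R σ).started q) :
    Fresh A init R (σ ++ [p]) q j v := by
  obtain ⟨ρ, h1, h2, h3⟩ := h
  exact ⟨ρ, h1.trans (List.prefix_append _ _), h2.trans hs.symm, h3⟩

/-- What a process in the middle of a task knows. -/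
def PhaseInv (A : Algorithm n V) (init : Fin n → V) (R : Requests n V) (σ : List (Fin n))
    (q : Fin n) : Phase n V → Prop
  | .start _ => False
  | .peek _ => True
  | .check p c => ∃ ρ, ρ <+: σ ∧ (A.run R ρ).started q = (A.run R σ).started q ∧
      (A.run R ρ).started p = c
  | .gather todo x => ∀ j, j ∉ todo → Fresh A init R σ q j (x j)

theorem PhaseInv.append {A : Algorithm n V} {σ : List (Fin n)} {q p : Fin n} {ph : Phase n V}
    (h : PhaseInv A init R σ q ph)
    (hs : (A.run R (σ ++ [p])).started q = (A.run R σ).started q) :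
    PhaseInv A init R (σ ++ [p]) q ph := by
  cases ph with
  | start _ => exact h
  | peek _ => exact h
  | check r c =>
    obtain ⟨ρ, h1, h2, h3⟩ := h
    exact ⟨ρ, h1.trans (List.prefix_append _ _), h2.trans hs.symm, h3⟩
  | gather todo x => exact fun j hj => (h j hj).append hs

/-- What the local state and the registers of `q` say. -/
structure Inv (init : Fin n → V) (plan : Fin n → List (Option (Fin n))) (R : Requests n V)
    (σ : List (Fin n)) (s : LocalState n V) (mem : ℕ → Entry n V) (q : Fin n) : Prop where
  count : s.count = ((algorithm init plan).run R σ).started q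
  val : s.val = (algorithm init plan).objectValue init R σ q
  mem_count : (mem 0).count = ((algorithm init plan).run R σ).started q
  mem_val : (mem 0).val = (algorithm init plan).objectValue init R σ q
  vec : ∀ j, ∃ ρ, ρ <+: σ ∧ ((algorithm init plan).run R ρ).started q = (mem 1).count ∧
    (mem 1).vec j = (algorithm init plan).objectValue init R ρ j
  phase : ¬ ((algorithm init plan).run R σ).Idle q →
    PhaseInv (algorithm init plan) init R σ q s.phase

/-- The invariants of all processes are carried together because a step relies on what the registers
of another process mean. The plan plays no role: hints affect speed, never correctness. -/
theorem inv_step {σ : List (Fin n)} {p : Fin n}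
    (h : ∀ q, Inv init plan R σ (((algorithm init plan).run R σ).loc q) (((algorithm init plan).run R σ).mem q) q) :
    (∀ x, ((algorithm init plan).stepOutcome R ((algorithm init plan).run R σ) p).2 = some x →
      ∀ j, Fresh (algorithm init plan) init R (σ ++ [p]) p j (x j)) ∧
    ∀ q, Inv init plan R (σ ++ [p]) (((algorithm init plan).run R (σ ++ [p])).loc q)
      (((algorithm init plan).run R (σ ++ [p])).mem q) q := by
  have hpre : σ <+: σ ++ [p] := List.prefix_append _ _
  have hrun := run_append_singleton (algorithm init plan) R σ p
  have hloc : ((algorithm init plan).run R (σ ++ [p])).loc p =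
      ((algorithm init plan).stepOutcome R ((algorithm init plan).run R σ) p).1 := by
    rw [hrun]
    simp [step]
  have hmem : ((algorithm init plan).run R (σ ++ [p])).mem =
      (algorithm init plan).stepMem R ((algorithm init plan).run R σ) p := by
    rw [hrun]
    rfl
  have hidle := idle_step_iff (A := algorithm init plan) (R := R) σ p
  have hvec : ∀ q, ((algorithm init plan).run R (σ ++ [p])).mem q 1 = ((algorithm init plan).run R σ).mem q 1 →
      ∀ j, ∃ ρ, ρ <+: σ ++ [p] ∧
        ((algorithm init plan).run R ρ).started q = (((algorithm init plan).run R (σ ++ [p])).mem q 1).count ∧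
        (((algorithm init plan).run R (σ ++ [p])).mem q 1).vec j = (algorithm init plan).objectValue init R ρ j := by
    intro q hq j
    rw [hq]
    obtain ⟨ρ, h1, h2⟩ := (h q).vec j
    exact ⟨ρ, h1.trans hpre, h2⟩
  suffices hmain : (∀ x, ((algorithm init plan).stepOutcome R ((algorithm init plan).run R σ) p).2 = some x →
      ∀ j, Fresh (algorithm init plan) init R (σ ++ [p]) p j (x j)) ∧
      Inv init plan R (σ ++ [p]) (((algorithm init plan).run R (σ ++ [p])).loc p)
        (((algorithm init plan).run R (σ ++ [p])).mem p) p by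
    refine ⟨hmain.1, fun q => ?_⟩
    by_cases hq : q = p
    · subst hq
      exact hmain.2
    · have hsame := sameAt_step_of_ne (A := algorithm init plan) (R := R) ((algorithm init plan).run R σ) hq
      rw [← hrun] at hsame
      have hov := objectValue_append_of_started (init := init) hsame.2.2.1
      have hq' := h q
      refine ⟨?_, ?_, ?_, ?_, hvec q (by rw [hsame.2.1]), fun hi => ?_⟩
      · rw [hsame.1, hsame.2.2.1, hq'.count]
      · rw [hsame.1, hov, hq'.val]
      · rw [hsame.2.1, hsame.2.2.1, hq'.mem_count]
      · rw [hsame.2.1, hov, hq'.mem_val]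
      · rw [hsame.1]
        exact (hq'.phase (mt hsame.idle_iff.2 hi)).append hsame.2.2.1
  have hp := h p
  by_cases hi : ((algorithm init plan).run R σ).Idle p
  · -- the first operation of a task
    obtain ⟨s, hs⟩ : ∃ s : LocalState n V,
      s = (algorithm init plan).invoke p (((algorithm init plan).run R σ).loc p)
        (R p (((algorithm init plan).run R σ).started p)) := ⟨_, rfl⟩
    have hst : (algorithm init plan).stepState R ((algorithm init plan).run R σ) p = s := by
      rw [hs, stepState, if_pos hi]
    have hstart : ((algorithm init plan).run R (σ ++ [p])).started p =
        ((algorithm init plan).run R σ).started p + 1 := by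
      rw [hrun, started_step_of_idle hi]
    have hov : (algorithm init plan).objectValue init R (σ ++ [p]) p = s.val := by
      rw [objectValue, hstart, written_succ, hs]
      change _ = Task.newValue _ (((algorithm init plan).run R σ).loc p).val
      rw [hp.val]
      rfl
    have hcount : s.count = ((algorithm init plan).run R σ).started p + 1 := by
      rw [hs, ← hp.count]
    obtain ⟨hout, hm⟩ := step_start hst
      (hint := (((algorithm init plan).run R σ).loc p).plan.head?.join)
      (by rw [hs])
    rw [hloc, hout]
    refine ⟨by simp, ⟨by rw [hstart, hcount], hov.symm, ?_, ?_, hvec p ?_, fun _ => ?_⟩⟩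
    · rw [hmem, hm, hstart]
      simpa using hcount
    · rw [hmem, hm, hov]
      simp
    · rw [hmem, hm]
      simp
    · change PhaseInv _ _ _ _ _ (Phase.ofHint _ _)
      cases (((algorithm init plan).run R σ).loc p).plan.head?.join with
      | some r => trivial
      | none => exact fun j hj => absurd (List.mem_finRange j) hj
  · have hstart : ((algorithm init plan).run R (σ ++ [p])).started p = ((algorithm init plan).run R σ).started p := by
      rw [hrun, started_step_of_not_idle hi]
    have hov := objectValue_append_of_started (init := init) hstart
    obtain ⟨s, hs⟩ : ∃ s : LocalState n V, s = ((algorithm init plan).run R σ).loc p := ⟨_, rfl⟩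
    have hst : (algorithm init plan).stepState R ((algorithm init plan).run R σ) p = s := by
      rw [hs, stepState, if_neg hi]
    rw [← hs] at hp
    have hph := (hp.phase hi).append (p := p) hstart
    have hmid : ∀ s' : LocalState n V, s'.count = s.count → s'.val = s.val →
        ((algorithm init plan).stepMem R ((algorithm init plan).run R σ) p p 0 = ((algorithm init plan).run R σ).mem p 0) →
        (∀ j, ∃ ρ, ρ <+: σ ++ [p] ∧
          ((algorithm init plan).run R ρ).started p = (((algorithm init plan).run R (σ ++ [p])).mem p 1).count ∧
          (((algorithm init plan).run R (σ ++ [p])).mem p 1).vec j =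
            (algorithm init plan).objectValue init R ρ j) →
        (¬ ((algorithm init plan).run R (σ ++ [p])).Idle p → PhaseInv (algorithm init plan) init R (σ ++ [p]) p s'.phase) →
        Inv init plan R (σ ++ [p]) s' (((algorithm init plan).run R (σ ++ [p])).mem p) p := by
      intro s' h1 h2 h3 h4 h5
      refine ⟨?_, ?_, ?_, ?_, h4, h5⟩
      · rw [h1, hstart, hp.count]
      · rw [h2, hov, hp.val]
      · rw [hmem, h3, hstart, hp.mem_count]
      · rw [hmem, h3, hov, hp.mem_val]
    cases hphase : s.phase with
    | start hint =>
      rw [hphase] at hph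
      exact hph.elim
    | peek r =>
      obtain ⟨hout, hm⟩ := step_peek hst hphase
      rw [hloc, hout]
      refine ⟨by simp, hmid _ rfl rfl (by rw [hm]) (hvec p (by rw [hmem, hm])) fun _ => ?_⟩
      exact ⟨σ, hpre, hstart.symm, (h r).mem_count.symm⟩
    | check r k =>
      obtain ⟨hout, hm⟩ := step_check hst hphase
      rw [hphase] at hph
      rw [hloc]
      by_cases hk : k < (((algorithm init plan).run R σ).mem r 1).count
      · rw [if_pos hk] at hout
        rw [hout] at hidle ⊢
        refine ⟨?_, hmid _ rfl rfl (by rw [hm]) (hvec p (by rw [hmem, hm])) fun hni =>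
          absurd (hidle.2 rfl) hni⟩
        rintro x hx j
        obtain rfl : (((algorithm init plan).run R σ).mem r 1).vec = x := Option.some_injective _ hx
        obtain ⟨ρ₁, h1, h2, h3⟩ := (h r).vec j
        obtain ⟨ρ₀, h4, h5, h6⟩ := hph
        -- The borrowed entry dates from a moment `ρ₁` at which `r` had started more than `k` tasks,
        -- hence from after the moment `ρ₀` of the peek, and so from within the current task of `p`.
        refine ⟨ρ₁, h1.trans hpre, le_antisymm (started_mono (h1.trans hpre) p) ?_, h3⟩
        rw [← h5]
        refine started_mono ?_ p
        refine (List.prefix_or_prefix_of_prefix h4 (h1.trans hpre)).resolve_right fun hle => ?_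
        have := started_mono (A := algorithm init plan) (R := R) hle r
        omega
      · rw [if_neg hk] at hout
        rw [hout]
        refine ⟨by simp, hmid _ rfl rfl (by rw [hm]) (hvec p (by rw [hmem, hm])) fun _ => ?_⟩
        exact fun j hj => absurd (List.mem_finRange j) hj
    | gather todo x =>
      rw [hphase] at hph
      cases todo with
      | nil =>
        obtain ⟨hout, hm⟩ := step_gather_nil hst hphase
        rw [hloc]
        rw [hout] at hidle ⊢
        have hx : ∀ j, Fresh (algorithm init plan) init R (σ ++ [p]) p j (x j) := fun j => hph j (by simp)
        refine ⟨?_, hmid _ rfl rfl (by rw [hm]; simp) ?_ fun hni => absurd (hidle.2 rfl) hni⟩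
        · rintro y hy j
          obtain rfl : x = y := Option.some_injective _ hy
          exact hx j
        · intro j
          obtain ⟨ρ, h1, h2, h3⟩ := hx j
          refine ⟨ρ, h1, ?_, ?_⟩
          · rw [hmem, hm, h2, hstart]
            simpa using hp.count.symm
          · rw [hmem, hm, ← h3]
            simp
      | cons r todo =>
        obtain ⟨hout, hm⟩ := step_gather_cons hst hphase
        rw [hloc, hout]
        refine ⟨by simp, hmid _ rfl rfl (by rw [hm]) (hvec p (by rw [hmem, hm])) fun _ => ?_⟩
        intro j hj
        by_cases hjr : j = r
        · subst hjr
          rw [Function.update_self]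
          exact ⟨σ, hpre, hstart.symm, (h j).mem_val⟩
        · rw [Function.update_of_ne hjr]
          exact hph j (by simp [hjr, hj])

theorem inv_run (σ : List (Fin n)) (q : Fin n) :
    Inv init plan R σ (((algorithm init plan).run R σ).loc q) (((algorithm init plan).run R σ).mem q) q := by
  induction σ using List.reverseRecOn generalizing q with
  | nil =>
    -- Register `1` initially holds task number `0` and the initial values, which are the contents
    -- at the empty schedule.
    refine ⟨rfl, rfl, rfl, rfl, fun j => ⟨[], List.prefix_rfl, rfl, rfl⟩, fun h => ?_⟩
    exact absurd rfl h
  | append_singleton σ p ih => exact (inv_step ih).2 q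

theorem implements (init : Fin n → V) (plan : Fin n → List (Option (Fin n)))
    (T : Set (Task V)) : (algorithm init plan).Implements init T :=
  fun _ _ σ _ x hx q => (inv_step (inv_run σ)).1 x hx q

end Champion

end CollectModel

/-! ### Progress of the champion in the adversary's schedule -/

namespace CollectModel

namespace Algorithm

/-- Each process of `F` takes a step, in the presence of an inactive process `p`. -/
theorem foldl_pass {n : ℕ} {V : Type u} {A : Algorithm n V} {R : Requests n V} {p : Fin n}
    {X Y : Fin n → A.Config → Prop}
    (hX : ∀ f c d, SameAt c d f → SameAt c d p → X f c → X f d)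
    (hY : ∀ f c d, SameAt c d f → SameAt c d p → Y f c → Y f d)
    (hstep : ∀ f c, f ≠ p → X f c → Y f (A.step R c f))
    {F : List (Fin n)} (hF : F.Nodup) (hp : p ∉ F) (c : A.Config) (hc : ∀ f ∈ F, X f c) :
    ∀ f ∈ F, Y f (F.foldl (A.step R) c) := by
  induction F generalizing c with
  | nil => simp
  | cons g F ih =>
    simp only [List.nodup_cons, List.mem_cons, not_or] at hF hp hc ⊢
    intro f hf
    rw [List.foldl_cons]
    rcases hf with rfl | hf
    · exact hY f _ _ (sameAt_foldl _ hF.1).symm (sameAt_foldl _ hp.2).symm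
        (hstep f c (Ne.symm hp.1) (hc f (Or.inl rfl)))
    · refine ih hF.2 hp.2 _ (fun f hf => ?_) f hf
      have hfg : f ≠ g := fun h => hF.1 (h ▸ hf)
      exact hX f _ _ (sameAt_step_of_ne c hfg).symm (sameAt_step_of_ne c hp.1).symm
        (hc f (Or.inr hf))

end Algorithm

namespace Champion

open Algorithm

variable {n : ℕ} {V : Type u} {init : Fin n → V} {plan : Fin n → List (Option (Fin n))}
  {R : Requests n V}

/-- Process `q` is between tasks, with announced task number and with plan `P`. -/
structure Ready (c : (algorithm init plan).Config) (q : Fin n) (P : List (Option (Fin n))) :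
    Prop where
  idle : c.Idle q
  announced : (c.mem q 0).count = (c.loc q).count
  plan_eq : (c.loc q).plan = P

/-- Process `q` is in the control state `ph` of its task number `k`, after `m` completed tasks. -/
structure Busy (c : (algorithm init plan).Config) (q : Fin n) (P : List (Option (Fin n)))
    (ph : Phase n V) (k m : ℕ) : Prop where
  started : c.started q = c.completed q + 1
  announced : (c.mem q 0).count = k
  count : (c.loc q).count = k
  plan_eq : (c.loc q).plan = P
  phase : (c.loc q).phase = ph
  completed : c.completed q = m

theorem Ready.congr {c d : (algorithm init plan).Config} {q : Fin n}
    {P : List (Option (Fin n))} (h : Ready c q P) (hs : SameAt c d q) : Ready d q P :=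
  ⟨hs.idle_iff.1 h.idle, by rw [← hs.1, ← hs.2.1, h.announced], by rw [← hs.1, h.plan_eq]⟩

theorem Busy.congr {c d : (algorithm init plan).Config} {q : Fin n}
    {P : List (Option (Fin n))} {ph : Phase n V} {k m : ℕ} (h : Busy c q P ph k m)
    (hs : SameAt c d q) : Busy d q P ph k m :=
  ⟨by rw [← hs.2.2.1, ← hs.2.2.2, h.started], by rw [← hs.2.1, h.announced],
    by rw [← hs.1, h.count], by rw [← hs.1, h.plan_eq], by rw [← hs.1, h.phase],
    by rw [← hs.2.2.2, h.completed]⟩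

section

variable {c : (algorithm init plan).Config} {q : Fin n} {P : List (Option (Fin n))}
  {ph : Phase n V} {k m : ℕ}

theorem Busy.stepState (h : Busy c q P ph k m) :
    (algorithm init plan).stepState R c q = c.loc q := by
  unfold Algorithm.stepState
  rw [if_neg]
  unfold Config.Idle
  have := h.started
  omega

theorem Busy.not_idle (h : Busy c q P ph k m) : ¬ c.Idle q := by
  unfold Config.Idle
  have := h.started
  omega

/-- A step within a task that does not write. -/
theorem Busy.step_of_none (h : Busy c q P ph k m) {s : LocalState n V}
    (ho : (algorithm init plan).stepOutcome R c q = (s, none))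
    (hm : (algorithm init plan).stepMem R c q = c.mem) (hs : s.count = k) (hs' : s.plan = P) :
    Busy ((algorithm init plan).step R c q) q P s.phase k m := by
  have hloc : ((algorithm init plan).step R c q).loc q = s := by simp [step, ho]
  have hmem : ((algorithm init plan).step R c q).mem = c.mem := hm
  have hst := started_step_of_not_idle (R := R) h.not_idle
  have hc := completed_step_of_none (R := R) (c := c) (p := q) (by simp [ho])
  exact ⟨by rw [hst, hc, h.started], by rw [hmem, h.announced], by rw [hloc, hs],
    by rw [hloc, hs'], by rw [hloc], by rw [hc, h.completed]⟩

/-- The final step of a task. -/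
theorem Busy.step_of_some (h : Busy c q P ph k m) {x : Fin n → V}
    (ho : (algorithm init plan).stepOutcome R c q = (c.loc q, some x))
    (hm : (algorithm init plan).stepMem R c q q 0 = c.mem q 0) :
    Ready ((algorithm init plan).step R c q) q P ∧
      ((algorithm init plan).step R c q).loc q = c.loc q ∧
      ((algorithm init plan).step R c q).completed q = m + 1 := by
  have hloc : ((algorithm init plan).step R c q).loc q = c.loc q := by simp [step, ho]
  have hst := started_step_of_not_idle (R := R) h.not_idle
  have hc := completed_step_of_some (R := R) (c := c) (p := q) (by simp [ho])
  refine ⟨⟨?_, ?_, by rw [hloc, h.plan_eq]⟩, hloc, by rw [hc, h.completed]⟩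
  · unfold Config.Idle
    rw [hst, hc, h.started]
  · rw [hloc, h.count, ← h.announced, ← hm]
    rfl

theorem Ready.step {hint : Option (Fin n)} (h : Ready c q (hint :: P)) :
    Busy ((algorithm init plan).step R c q) q P (.ofHint init hint) ((c.loc q).count + 1)
      (c.completed q) := by
  obtain ⟨s, hs⟩ : ∃ s : LocalState n V,
    s = (algorithm init plan).invoke q (c.loc q) (R q (c.started q)) := ⟨_, rfl⟩
  have hst : (algorithm init plan).stepState R c q = s := by
    rw [hs, Algorithm.stepState, if_pos h.idle]
  have hph : s.phase = .start hint := by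
    rw [hs]
    change Phase.start (c.loc q).plan.head?.join = _
    rw [h.plan_eq]
    rfl
  have hcount : s.count = (c.loc q).count + 1 := by rw [hs]
  have hplan : s.plan = P := by
    rw [hs]
    change (c.loc q).plan.tail = _
    rw [h.plan_eq]
    rfl
  obtain ⟨ho, hm⟩ := step_start hst hph
  have hloc : ((algorithm init plan).step R c q).loc q =
      { s with phase := .ofHint init hint } := by simp [Algorithm.step, ho]
  have hmem : ((algorithm init plan).step R c q).mem q 0 = ⟨s.count, s.val, init⟩ := by
    change (algorithm init plan).stepMem R c q q 0 = _
    rw [hm]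
    simp
  have hsta := started_step_of_idle (R := R) h.idle
  have hc := completed_step_of_none (R := R) (c := c) (p := q) (by simp [ho])
  refine ⟨?_, by rw [hmem, hcount], by rw [hloc, hcount], by rw [hloc, hplan], by rw [hloc], hc⟩
  rw [hsta, hc, h.idle]

theorem Busy.foldl_gather {todo : List (Fin n)} {x : Fin n → V}
    (h : Busy c q P (.gather todo x) k m) :
    Ready ((List.replicate (todo.length + 1) q).foldl ((algorithm init plan).step R) c) q P ∧
      (((List.replicate (todo.length + 1) q).foldl
        ((algorithm init plan).step R) c).mem q 1).count = k ∧
      ((List.replicate (todo.length + 1) q).foldl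
        ((algorithm init plan).step R) c).completed q = m + 1 := by
  induction todo generalizing c x with
  | nil =>
    obtain ⟨ho, hm⟩ := step_gather_nil (h.stepState (R := R)) h.phase
    obtain ⟨h1, h2, h3⟩ := h.step_of_some ho (by rw [hm]; simp)
    refine ⟨h1, ?_, h3⟩
    change ((algorithm init plan).stepMem R c q q 1).count = k
    rw [hm, ← h.count]
    simp
  | cons r todo ih =>
    obtain ⟨ho, hm⟩ := step_gather_cons (h.stepState (R := R)) h.phase
    have := h.step_of_none ho hm h.count h.plan_eq
    rw [List.length_cons, List.replicate_succ, List.foldl_cons]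
    exact ih this

/-- A task without a hint takes exactly `n + 2` steps: an announcement, `n` reads and a publication.
This fixes the length of the leader's block in `roundSchedule`. -/
theorem Ready.foldl_leader (h : Ready c q (none :: P)) :
    Ready ((List.replicate (n + 2) q).foldl ((algorithm init plan).step R) c) q P ∧
      (((List.replicate (n + 2) q).foldl
        ((algorithm init plan).step R) c).mem q 1).count = (c.loc q).count + 1 := by
  have h1 := (h.step (R := R)).foldl_gather (R := R)
  rw [List.length_finRange] at h1
  rw [List.replicate_succ, List.foldl_cons]
  exact ⟨h1.1, h1.2.1⟩

end

/-- The plan for the processes in an epoch with leader `p` and followers `F`. -/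
def epochPlan (h : ℕ) (p : Fin n) (F : List (Fin n)) (q : Fin n) : List (Option (Fin n)) :=
  if q = p then List.replicate h none else if q ∈ F then List.replicate h (some p) else []

theorem epochPlan_add (h h' : ℕ) (p : Fin n) (F : List (Fin n)) (q : Fin n) :
    epochPlan (h + h') p F q = epochPlan h p F q ++ epochPlan h' p F q := by
  unfold epochPlan
  split_ifs
  exacts [List.replicate_add _ _ _, List.replicate_add _ _ _, rfl]

/-- All followers peek before the leader starts its task and check after it has published, so each
finds a task number larger by one than the number it noted and finishes at its third step. -/
theorem round {p : Fin n} {F : List (Fin n)} (hF : F.Nodup) (hp : p ∉ F)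
    {c : (algorithm init plan).Config} {P : Fin n → List (Option (Fin n))}
    (hc : ∀ q, Ready c q (epochPlan 1 p F q ++ P q)) :
    (∀ q, Ready ((roundSchedule p F).foldl ((algorithm init plan).step R) c) q (P q)) ∧
      ∀ f ∈ F, ((roundSchedule p F).foldl ((algorithm init plan).step R) c).completed f =
        c.completed f + 1 := by
  let stp := (algorithm init plan).step R
  obtain ⟨c₁, hc₁⟩ : ∃ c₁, c₁ = F.foldl stp c := ⟨_, rfl⟩
  obtain ⟨c₂, hc₂⟩ : ∃ c₂, c₂ = F.foldl stp c₁ := ⟨_, rfl⟩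
  obtain ⟨c₃, hc₃⟩ : ∃ c₃, c₃ = (List.replicate (n + 2) p).foldl stp c₂ := ⟨_, rfl⟩
  obtain ⟨c₄, hc₄⟩ : ∃ c₄, c₄ = F.foldl stp c₃ := ⟨_, rfl⟩
  have hround : (roundSchedule p F).foldl ((algorithm init plan).step R) c = c₄ := by
    simp only [roundSchedule, List.foldl_append, hc₄, hc₃, hc₂, hc₁, stp]
  rw [hround]
  have hne : ∀ f ∈ F, f ≠ p := fun f hf h => hp (h ▸ hf)
  have hnp : ∀ f ∈ F, f ∉ List.replicate (n + 2) p := fun f hf h =>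
    hne f hf (List.eq_of_mem_replicate h)
  -- first operations of the followers
  have h₁ : ∀ f ∈ F, Busy c₁ f (P f) (.peek p) ((c.loc f).count + 1) (c.completed f) ∧
      SameAt c c₁ p := by
    rw [hc₁]
    -- Both conditions concern only `f` and the inactive leader, so the steps of the other followers
    -- preserve them.
    refine foldl_pass (X := fun f d => SameAt c d f ∧ SameAt c d p ∧ f ∈ F)
      (Y := fun f d => Busy d f (P f) (.peek p) ((c.loc f).count + 1) (c.completed f) ∧
        SameAt c d p) ?_ ?_ ?_ hF hp c fun f hf => ⟨SameAt.refl _ _, SameAt.refl _ _, hf⟩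
    · exact fun f d e h h' hX => ⟨hX.1.trans h, hX.2.1.trans h', hX.2.2⟩
    · exact fun f d e h h' hY => ⟨hY.1.congr h, hY.2.trans h'⟩
    · rintro f d hfp ⟨h1, h2, hf⟩
      have hr : Ready d f (some p :: P f) := by
        have := (hc f).congr h1
        simpa [epochPlan, hfp, hf] using this
      refine ⟨?_, h2.trans (sameAt_step_of_ne d (Ne.symm hfp)).symm⟩
      have := hr.step (R := R)
      rwa [← h1.1, ← h1.2.2.2] at this
  have hp₁ : SameAt c c₁ p := by
    rw [hc₁]
    exact (sameAt_foldl _ hp).symm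
  have hp₂ : SameAt c c₂ p := by
    rw [hc₂]
    exact hp₁.trans (sameAt_foldl _ hp).symm
  -- the followers learn the task number of the leader
  have h₂ : ∀ f ∈ F, Busy c₂ f (P f) (.check p (c.loc p).count) ((c.loc f).count + 1)
      (c.completed f) := by
    rw [hc₂]
    refine foldl_pass (p := p) (X := fun f d => Busy d f (P f) (.peek p) ((c.loc f).count + 1)
        (c.completed f) ∧ SameAt c d p)
      (Y := fun f d => Busy d f (P f) (.check p (c.loc p).count) ((c.loc f).count + 1)
        (c.completed f)) ?_ ?_ ?_ hF hp c₁ h₁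
    · exact fun f d e h h' hX => ⟨hX.1.congr h, hX.2.trans h'⟩
    · exact fun f d e h h' hY => hY.congr h
    · rintro f d hfp ⟨h1, h2⟩
      obtain ⟨ho, hm⟩ := step_peek (h1.stepState (R := R)) h1.phase
      have := h1.step_of_none ho hm h1.count h1.plan_eq
      rwa [← h2.2.1, (hc p).announced] at this
  -- the leader completes a task
  obtain ⟨hp₃, hp₃'⟩ : Ready c₃ p (P p) ∧ (c₃.mem p 1).count = (c.loc p).count + 1 := by
    have hr : Ready c₂ p (none :: P p) := by
      have := (hc p).congr hp₂
      simpa [epochPlan] using this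
    rw [hc₃, hp₂.1]
    exact hr.foldl_leader
  have h₃ : ∀ f ∈ F, Busy c₃ f (P f) (.check p (c.loc p).count) ((c.loc f).count + 1)
      (c.completed f) ∧ (c₃.mem p 1).count = (c.loc p).count + 1 := by
    intro f hf
    refine ⟨(h₂ f hf).congr ?_, hp₃'⟩
    rw [hc₃]
    exact (sameAt_foldl _ (hnp f hf)).symm
  -- the followers complete their tasks
  have h₄ : ∀ f ∈ F, Ready c₄ f (P f) ∧ c₄.completed f = c.completed f + 1 := by
    rw [hc₄]
    refine foldl_pass (p := p)
      (X := fun f d => Busy d f (P f) (.check p (c.loc p).count) ((c.loc f).count + 1)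
        (c.completed f) ∧ (d.mem p 1).count = (c.loc p).count + 1)
      (Y := fun f d => Ready d f (P f) ∧ d.completed f = c.completed f + 1)
      ?_ ?_ ?_ hF hp c₃ h₃
    · exact fun f d e h h' hX => ⟨hX.1.congr h, by rw [← h'.2.1, hX.2]⟩
    · exact fun f d e h h' hY => ⟨hY.1.congr h, by rw [← h.2.2.2, hY.2]⟩
    · rintro f d hfp ⟨h1, h2⟩
      obtain ⟨ho, hm⟩ := step_check (h1.stepState (R := R)) h1.phase
      rw [if_pos (by omega)] at ho
      have := h1.step_of_some ho (by rw [hm])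
      exact ⟨this.1, this.2.2⟩
  refine ⟨fun q => ?_, fun f hf => (h₄ f hf).2⟩
  by_cases hqp : q = p
  · subst hqp
    refine hp₃.congr ?_
    rw [hc₄]
    exact (sameAt_foldl _ hp).symm
  · by_cases hqF : q ∈ F
    · exact (h₄ q hqF).1
    · have hq : SameAt c c₄ q := by
        rw [← hround]
        refine (sameAt_foldl _ ?_).symm
        simp [roundSchedule, hqp, hqF]
      have := (hc q).congr hq
      simpa [epochPlan, hqp, hqF] using this

theorem epoch {p : Fin n} {F : List (Fin n)} (hF : F.Nodup) (hp : p ∉ F) (h : ℕ)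
    {c : (algorithm init plan).Config} {P : Fin n → List (Option (Fin n))}
    (hc : ∀ q, Ready c q (epochPlan h p F q ++ P q)) :
    (∀ q, Ready ((epochSchedule h p F).foldl ((algorithm init plan).step R) c) q (P q)) ∧
      ∀ f ∈ F, ((epochSchedule h p F).foldl ((algorithm init plan).step R) c).completed f =
        c.completed f + h := by
  induction h generalizing c with
  | zero => simpa [epochSchedule, epochPlan] using hc
  | succ h ih =>
    rw [epochSchedule_succ, List.foldl_append]
    obtain ⟨h1, h2⟩ := round (R := R) hF hp (c := c) (P := fun q => epochPlan h p F q ++ P q)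
      (fun q => by rw [← List.append_assoc, ← epochPlan_add, add_comm]; exact hc q)
    obtain ⟨h3, h4⟩ := ih h1
    refine ⟨h3, fun f hf => ?_⟩
    rw [h4 f hf, h2 f hf]
    omega

/-- The plan of process `q` for a sequence of epochs. -/
def epochsPlan (h : ℕ) (L : List (Fin n × List (Fin n))) (q : Fin n) : List (Option (Fin n)) :=
  L.flatMap fun e => epochPlan h e.1 e.2 q

/-- Only completions by followers are counted; those of the leaders are dropped. -/
theorem epochs {m : ℕ} (h : ℕ) {L : List (Fin n × List (Fin n))}
    (hL : ∀ e ∈ L, e.2.Nodup ∧ e.1 ∉ e.2 ∧ e.2.length = m)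
    {c : (algorithm init plan).Config} (hc : ∀ q, Ready c q (epochsPlan h L q)) :
    ∑ q, c.completed q + L.length * (m * h) ≤
      ∑ q, ((epochsSchedule h L).foldl ((algorithm init plan).step R) c).completed q := by
  induction L generalizing c with
  | nil => simp [epochsSchedule]
  | cons e L ih =>
    obtain ⟨hF, hp, hm⟩ := hL e List.mem_cons_self
    have hs : epochsSchedule h (e :: L) = epochSchedule h e.1 e.2 ++ epochsSchedule h L := by
      simp [epochsSchedule]
    obtain ⟨h1, h2⟩ := epoch (R := R) hF hp h (c := c) (P := epochsPlan h L)
      (fun q => by simpa [epochsPlan] using hc q)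
    have h3 := ih (fun e he => hL e (List.mem_cons_of_mem _ he)) h1
    rw [hs, List.foldl_append]
    refine le_trans ?_ h3
    have h4 : ∑ q, (c.completed q + if q ∈ e.2.toFinset then h else 0) ≤
        ∑ q, ((epochSchedule h e.1 e.2).foldl ((algorithm init plan).step R) c).completed q := by
      refine Finset.sum_le_sum fun q _ => ?_
      by_cases hq : q ∈ e.2
      · simp [hq, h2 q hq]
      · simpa [hq] using completed_le_foldl c (epochSchedule h e.1 e.2) q
    rw [Finset.sum_add_distrib] at h4
    simp only [Finset.sum_ite_mem, Finset.univ_inter, Finset.sum_const, smul_eq_mul,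
      List.toFinset_card_of_nodup hF, hm] at h4
    rw [List.length_cons, add_mul]
    omega

/-- With the right plan, all followers complete a task in each round. -/
theorem done_epochs (init : Fin n → V) (R : Requests n V) {m : ℕ} (h : ℕ)
    {L : List (Fin n × List (Fin n))}
    (hL : ∀ e ∈ L, e.2.Nodup ∧ e.1 ∉ e.2 ∧ e.2.length = m) :
    L.length * (m * h) ≤
      (algorithm init (epochsPlan h L)).done (epochsSchedule h L) R := by
  have := epochs (init := init) (plan := epochsPlan h L) (R := R) h hL
    (c := (algorithm init (epochsPlan h L)).initConfig) fun q => ⟨rfl, rfl, rfl⟩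
  refine le_trans (Nat.le_add_left _ _) this

end Champion

/-! ### Comparing the algorithm with the champion -/

namespace Algorithm

variable {n : ℕ} {V : Type u} {A : Algorithm n V} {init : Fin n → V} {T Q : Set (Task V)}

/-- In `opt` the schedule is fixed before the champion, so a plan made for `σ` may be hardwired. The
champion may face the same requests `R` as `A`. -/
theorem done_le_opt {R : Requests n V} (hR : ∀ p i, R p i ∈ Q)
    (plan : Fin n → List (Option (Fin n))) (σ : List (Fin n)) :
    (Champion.algorithm init plan).done σ R ≤ opt init T Q σ :=
  le_csSup (bddAbove_championScores init T Q σ)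
    ⟨_, Champion.implements init plan T, Champion.waitFree init plan T, R, hR, rfl⟩

/-- A competitive algorithm lets each process that runs alone complete its task: a champion
completes arbitrarily many tasks meanwhile. -/
theorem ThroughputCompetitive.obstructionFree {k : ℝ}
    (hA : A.ThroughputCompetitive init T Q k) (hQT : Q ⊆ T) {R : Requests n V}
    (hR : ∀ p i, R p i ∈ Q) : A.ObstructionFree R := by
  intro σ p
  by_contra! hidle
  obtain ⟨hk, C, hC⟩ := hA
  have hnone : ∀ i, ¬ (A.stepOutcome R (A.run R (σ ++ List.replicate i p)) p).2.isSome := by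
    intro i hi
    refine hidle (i + 1) ?_
    rw [List.replicate_succ', ← List.append_assoc]
    exact (idle_step_iff _ _).2 hi
  have hdone : ∀ i, A.done (σ ++ List.replicate i p) R = A.done σ R := by
    intro i
    refine Finset.sum_congr rfl fun q _ => ?_
    by_cases hq : q = p
    · subst hq
      exact completed_solo_of_none fun j _ => hnone j
    · exact (sameAt_run_append σ fun h => hq (List.eq_of_mem_replicate h)).2.2.2
  obtain ⟨N, hN⟩ := exists_nat_gt (k * (A.done σ R + C))
  let B := Champion.algorithm init fun _ => []
  let τ : ℕ → Fin n := fun t => (σ[t]?).getD p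
  have hτ : ∀ t, ∃ t', t ≤ t' ∧ τ t' = p := fun t =>
    ⟨t + σ.length, by omega, by simp [τ]⟩
  have hτσ : ∀ i, (List.range (σ.length + i)).map τ = σ ++ List.replicate i p := by
    intro i
    refine List.ext_getElem (by simp) fun j h1 h2 => ?_
    simp only [List.getElem_map, List.getElem_range, List.getElem_append, τ]
    split_ifs with hj
    · simp [hj]
    · simp [List.getElem?_eq_none (not_lt.1 hj)]
  obtain ⟨t, ht⟩ := Champion.waitFree init (fun _ => []) T R (fun p i => hQT (hR p i)) τ p hτ N
  have h1 : N ≤ (B.run R (σ ++ List.replicate t p)).completed p := by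
    -- The time `t` may fall within `σ`; running on to time `t + σ.length` loses no completions.
    rw [← hτσ, add_comm, List.range_add, List.map_append]
    exact ht.trans (completed_mono (List.prefix_append _ _) p)
  have h2 : N ≤ opt init T Q (σ ++ List.replicate t p) :=
    (h1.trans (Finset.single_le_sum (f := (B.run R (σ ++ List.replicate t p)).completed)
      (fun _ _ => Nat.zero_le _) (Finset.mem_univ p))).trans (done_le_opt hR _ _)
  have h3 := hC (σ ++ List.replicate t p) R hR
  rw [hdone, ge_iff_le, one_div, inv_mul_le_iff₀ hk] at h3
  have h4 : (N : ℝ) ≤ opt init T Q (σ ++ List.replicate t p) := by exact_mod_cast h2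
  linarith

/-- The competitiveness is at least a third of the number of followers that can be kept
ignorant. -/
theorem ThroughputCompetitive.le {k : ℝ} (hk : A.ThroughputCompetitive init T Q k)
    (hA : A.Implements init T)
    (hT : ∃ v w : V, v ≠ w ∧ Task.writeCollect v ∈ T ∧ Task.writeCollect w ∈ T)
    (hQT : Q ⊆ T) (hQ : Q.Nonempty) (hn : 5 ≤ n) {m : ℕ} (hm : 0 < m)
    (hmn : (m + 1) * (2 * (3 * m) + 1) ≤ n) : (m : ℝ) / 3 ≤ k := by
  obtain ⟨t, ht⟩ := hQ
  let R : Requests n V := fun _ _ => t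
  have hR : ∀ p i, R p i ∈ Q := fun _ _ => ht
  have hO := hk.obstructionFree hQT hR
  obtain ⟨hk0, C, hC⟩ := hk
  by_contra! hlt
  have hm' : (0 : ℝ) < m := by exact_mod_cast hm
  have hpos : 0 < (m : ℝ) * (m - 3 * k) := mul_pos hm' (by linarith)
  -- After `M` epochs the champion has at least `M * m ^ 2` tasks and `A` at most `3 * m * M`. The
  -- excess `M * m * (m - 3 * k)` must outgrow the additive allowance `k * C`.
  obtain ⟨M, hM⟩ := exists_nat_gt (k * C / (m * (m - 3 * k)))
  rw [div_lt_iff₀ hpos] at hM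
  obtain ⟨L, hL, hLF, hd⟩ := exists_epochs (R := R) hA (fun p i => hQT (hR p i)) hT hO hn m m
    (by nlinarith) hmn M
  have h1 := (Champion.done_epochs init R m hLF).trans (done_le_opt (T := T) hR _ _)
  have h2 := hC (epochsSchedule m L) R hR
  rw [ge_iff_le, one_div, inv_mul_le_iff₀ hk0] at h2
  rw [hL] at h1
  have h1' : (M : ℝ) * (m * m) ≤ opt init T Q (epochsSchedule m L) := by exact_mod_cast h1
  have hd' : (A.done (epochsSchedule m L) R : ℝ) ≤ M * (m + 2 * m) := by exact_mod_cast hd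
  have := mul_le_mul_of_nonneg_left hd' hk0.le
  nlinarith

end Algorithm

end CollectModel

theorem theorem3 :
    ∃ c : ℝ, 0 < c ∧ ∃ N : ℕ, ∀ n : ℕ, N ≤ n →
      ∀ (V : Type u) (init : Fin n → V) (T Q : Set (CollectModel.Task V)),
        (∃ v w : V, v ≠ w ∧ CollectModel.Task.writeCollect v ∈ T ∧
          CollectModel.Task.writeCollect w ∈ T) →
        Q ⊆ T → Q.Nonempty →
        ∀ (A : CollectModel.Algorithm.{u} n V), A.Implements init T →
          ∀ k : ℝ, A.ThroughputCompetitive init T Q k → c * Real.sqrt (n : ℝ) ≤ k := by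
  -- With `m = ⌊√n / 4⌋` and `√n ≥ 8`, the number `(m + 1) * (6 * m + 1)` is at most `n`, while `m >
  -- √n / 4 - 1 ≥ √n / 8`; hence `m / 3 ≥ √n / 24`.
  refine ⟨1 / 24, by norm_num, 64, fun n hn V init T Q hT hQT hQ A hA k hk => ?_⟩
  have hs0 := Real.sqrt_nonneg (n : ℝ)
  have hsq : Real.sqrt n * Real.sqrt n = n := Real.mul_self_sqrt (Nat.cast_nonneg n)
  have hs8 : (8 : ℝ) ≤ Real.sqrt n := by
    refine Real.le_sqrt_of_sq_le ?_
    have : (64 : ℝ) ≤ n := by exact_mod_cast hn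
    linarith
  have hfloor := Nat.floor_le (show 0 ≤ Real.sqrt n / 4 by positivity)
  have hfloor' := Nat.lt_floor_add_one (Real.sqrt n / 4)
  set m := ⌊Real.sqrt n / 4⌋₊
  have hm : (1 : ℝ) < m := by linarith
  have hm1 : 1 < m := by exact_mod_cast hm
  have hmn : (m + 1) * (2 * (3 * m) + 1) ≤ n := by
    have : ((m : ℝ) + 1) * (2 * (3 * m) + 1) ≤ n := by nlinarith
    exact_mod_cast this
  have := hk.le hA hT hQT hQ (by omega) (by omega) hmn
  linarith
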